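/- Consider a finite simple graph $\mathcal G$ on nodes $1,\dots,I$ with unknown states $x_i\in\mathbb R^{n_i}$, self measurements $z_i=C_ix_i+v_i$ at the nodes (possibly of dimension $0$) and joint measurements $z_{i,j}=C_{i,j}x_i+C_{j,i}x_j+v_{i,j}$ on the edges $(i,j)=(j,i)$ of $\mathcal G$, where the noises $v_i,v_{i,j}$ are independent centered Gaussian vectors with covariances $R_i>0$, $R_{i,j}=R_{j,i}>0$. Let $\mathcal N_i$ be the set of neighbours of $i$, and let $f(X)$, $X=(x_1,\dots,x_I)$, be the joint likelihood, i.e. the product of the corresponding Gaussian densities; assume that $f$ is integrable. Let $\Sigma_i^{ML}$ be the covariance matrix of $x_i$ under the (normalized) marginal of $f$, and $Q_i^{ML}=(\Sigma_i^{ML})^{-1}$. Matrix inequalities are in the Loewner order. Put $\Omega_{i,j}=C_i^TR_i^{-1}C_i+\sum_{w\in\mathcal N_i\setminus j}C_{i,w}^TR_{i,w}^{-1}C_{i,w}$ and assume (Assumption 1) that $\Omega_{i,j}>C_{i,j}^TR_{i,j}^{-1}C_{i,j}$ for all $i$ and all $j\in\mathcal N_i$. Belief propagation is the recursion with $Q_{i,j\to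 i}(0)=C_{i,j}^TR_{i,j}^{-1}C_{i,j}$ and, for $k\ge1$, $$Q_i(k)=C_i^TR_i^{-1}C_i+\sum_{j\in\mathcal N_i}Q_{i,j\to i}(k-1),\qquad Q_{i\to i,j}(k)=Q_i(k)-Q_{i,j\to i}(k-1),$$ $$R_{i,j\to j}(k)=R_{i,j}+C_{i,j}Q_{i\to i,j}^{-1}(k)C_{i,j}^T,\qquad Q_{i,j\to j}(k)=C_{j,i}^TR_{i,j\to j}^{-1}(k)C_{j,i}.$$ When the messages converge, with limits $Q_{i\to i,j}(\infty)>0$ and $R_{i,j\to j}(\infty)$, define, with maxima over all ordered pairs of adjacent nodes and spectral norms, $$\rho=\max_{i,j}\Vert R_{i,j\to j}^{-1/2}(\infty)C_{i,j}Q_{i\to i,j}^{-1}(\infty)C_{i,j}^TR_{i,j\to j}^{-1/2}(\infty)\Vert,\qquad \alpha=\max_{i,j}\Vert Q_{i\to i,j}^{-1/2}(\infty)\Omega_{i,j}Q_{i\to i,j}^{-1/2}(\infty)-I\Vert .$$ Let $\mathcal G_i(d)$ be the subgraph of $\mathcal G$ induced on the nodes within $d$ hops from $i$, and let the cycle-free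 depth $d_i$ be the largest $d$ such that $\mathcal G_i(d)$ is acyclic ($d_i=\infty$ if all of them are). For $d_i<\infty$ the reduced graph $\tilde{\mathcal G}_i$ is obtained from $\mathcal G_i(d_i)$ by attaching, for each node $s$ outside of $\mathcal G_i(d_i)$ that is adjacent to exactly $p\ge1$ nodes $u$ of $\mathcal G_i(d_i)$ (a child node), $p$ copies of $s$, one as a leaf to each such $u$. All measurements are copied, except that the self measurement noise covariance at each copy of $s$ is $pR_s$. Let $\tilde\Omega$, $\tilde\alpha_i$, $\tilde\rho_i$ be the quantities $\Omega$, $\alpha$, $\rho$ of the system on $\tilde{\mathcal G}_i$. Then for every node $i$: 1. If $1\le d_i<\infty$, then $0\le Q_i(d_i)-Q_i^{ML}$. 2. If $2\le d_i<\infty$ and $\tilde\Omega_{a,b}>0$ for all adjacent $a,b$ in $\tilde{\mathcal G}_i$ (so that belief propagation on $\tilde{\mathcal G}_i$ is defined), then on $\tilde{\mathcal G}_i$ all $\tilde Q_{a\to a,b}(k)$ and $\tilde R_{a,b\to b}(k)$ converge, the limits $\tilde Q_{a\to a,b}(\infty)$ are positive definite, $\tilde\rho_i<1$, and $$0\le Q_i(d_i)-Q_i^{ML}\le\tilde\alpha_i\tilde\rho_i^{\,d_i-1}Q_i^{ML}.$$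 3. If $d_i=\infty$, then $Q_i(k)\to Q_i^{ML}$ as $k\to\infty$. -/

import Mathlib

open Filter Topology MeasureTheory
open scoped Matrix

/-- A static estimation system with variable nodes `V`. Node `i` has a state `x i ∈ ℝ^(n i)` and a
self measurement `z i = C i x i + v i`; every edge `e = s(i, j)` of the canonical graph carries a
joint measurement `z e = C e i x i + C e j x j + v e`. The noises are independent, Gaussian, centered
with covariances `R i` and `R e`. A node without self measurement has `m i = 0`.
Values of `jointR e`, `jointC e i` for `e` not an edge, or `i` not an endpoint of `e`, are unused. -/
structure MeasurementSystem (V : Type*) where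
  /-- the canonical graph: `i` and `j` are adjacent when they have a joint measurement -/
  graph : SimpleGraph V
  /-- dimension of the state of a node -/
  n : V → ℕ
  /-- dimension of the self measurement of a node -/
  m : V → ℕ
  /-- dimension of the joint measurement on an edge -/
  l : Sym2 V → ℕ
  /-- `C_i` -/
  selfC : (i : V) → Matrix (Fin (m i)) (Fin (n i)) ℝ
  /-- `R_i` -/
  selfR : (i : V) → Matrix (Fin (m i)) (Fin (m i)) ℝ
  /-- `jointC s(i, j) i` is `C_{i,j}` and `jointC s(i, j) j` is `C_{j,i}` -/
  jointC : (e : Sym2 V) → (i : V) → Matrix (Fin (l e)) (Fin (n i)) ℝ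
  /-- `R_{i,j} = R_{j,i}` -/
  jointR : (e : Sym2 V) → Matrix (Fin (l e)) (Fin (l e)) ℝ
  selfR_pos : ∀ i, (selfR i).PosDef
  jointR_pos : ∀ e ∈ graph.edgeSet, (jointR e).PosDef

/-- The density at `v` of the centered Gaussian law on `ℝ^k` with covariance matrix `R`. -/
noncomputable def gaussianDensity {k : ℕ} (R : Matrix (Fin k) (Fin k) ℝ) (v : Fin k → ℝ) : ℝ :=
  (Real.sqrt ((2 * Real.pi) ^ k * R.det))⁻¹ * Real.exp (-(v ⬝ᵥ (R⁻¹ *ᵥ v)) / 2)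

/-- `Q^{-1/2}`. -/
noncomputable def invSqrt {k : ℕ} (Q : Matrix (Fin k) (Fin k) ℝ) : Matrix (Fin k) (Fin k) ℝ :=
  open scoped MatrixOrder in CFC.sqrt Q⁻¹

/-- The spectral norm (operator norm for the Euclidean norm) of a square matrix. -/
noncomputable def spectralNorm₂ {k : ℕ} (A : Matrix (Fin k) (Fin k) ℝ) : ℝ :=
  ‖Matrix.toEuclideanCLM (n := Fin k) (𝕜 := ℝ) A‖

namespace MeasurementSystem

variable {V : Type*} [Fintype V] (N : MeasurementSystem V)

/-- `C_iᵀ R_i⁻¹ C_i`. -/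
noncomputable def selfInfo (i : V) : Matrix (Fin (N.n i)) (Fin (N.n i)) ℝ :=
  (N.selfC i)ᵀ * (N.selfR i)⁻¹ * N.selfC i

/-- `C_{i,j}ᵀ R_{i,j}⁻¹ C_{i,j}`. -/
noncomputable def jointInfo (i j : V) : Matrix (Fin (N.n i)) (Fin (N.n i)) ℝ :=
  (N.jointC s(i, j) i)ᵀ * (N.jointR s(i, j))⁻¹ * N.jointC s(i, j) i

open Classical in
/-- `Ω_{i,j} = C_iᵀ R_i⁻¹ C_i + ∑_{w ∈ N_i \ j} C_{i,w}ᵀ R_{i,w}⁻¹ C_{i,w}`. -/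
noncomputable def omega (i j : V) : Matrix (Fin (N.n i)) (Fin (N.n i)) ℝ :=
  N.selfInfo i + ∑ w with N.graph.Adj i w ∧ w ≠ j, N.jointInfo i w

/-- The standing assumption `Ω_{i,j} > C_{i,j}ᵀ R_{i,j}⁻¹ C_{i,j}` for all `i` and all `j ∈ N_i`. -/
def Dominance : Prop :=
  ∀ i j, N.graph.Adj i j → (N.omega i j - N.jointInfo i j).PosDef

/-- `Ω_{i,j} > 0` for every edge: the condition needed for the message passing algorithm, which
inverts the matrices `Q_{i → i,j}(k)`, to be defined. -/
def OmegaPos : Prop :=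
  ∀ i j, N.graph.Adj i j → (N.omega i j).PosDef

/-! ### Belief propagation (information matrices)

`M i j` stands for the current message `Q_{i,j → i}`. -/

open Classical in
/-- `C_iᵀ R_i⁻¹ C_i + ∑_{j ∈ N_i} Q_{i,j → i}`. -/
noncomputable def nodeUpdate (M : (i j : V) → Matrix (Fin (N.n i)) (Fin (N.n i)) ℝ) (i : V) :
    Matrix (Fin (N.n i)) (Fin (N.n i)) ℝ :=
  N.selfInfo i + ∑ j with N.graph.Adj i j, M i j

/-- `Q_{i → i,j} = Q_i - Q_{i,j → i}`. -/
noncomputable def varUpdate (M : (i j : V) → Matrix (Fin (N.n i)) (Fin (N.n i)) ℝ) (i j : V) :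
    Matrix (Fin (N.n i)) (Fin (N.n i)) ℝ :=
  N.nodeUpdate M i - M i j

/-- `R_{i,j → j} = R_{i,j} + C_{i,j} Q_{i → i,j}⁻¹ C_{i,j}ᵀ`. -/
noncomputable def covUpdate (M : (i j : V) → Matrix (Fin (N.n i)) (Fin (N.n i)) ℝ) (i j : V) :
    Matrix (Fin (N.l s(i, j))) (Fin (N.l s(i, j))) ℝ :=
  N.jointR s(i, j) + N.jointC s(i, j) i * (N.varUpdate M i j)⁻¹ * (N.jointC s(i, j) i)ᵀ

/-- `msg k i j` is the message `Q_{i,j → i}(k)` from the factor node `(i, j)` to the variable node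
`i` after `k` iterations. -/
noncomputable def msg : ℕ → (i j : V) → Matrix (Fin (N.n i)) (Fin (N.n i)) ℝ
  | 0 => fun i j => N.jointInfo i j
  | k + 1 => fun i j =>
      (N.jointC s(j, i) i)ᵀ * (N.covUpdate (msg k) j i)⁻¹ * N.jointC s(j, i) i

/-- The information matrix `Q_i(k)`, `k ≥ 1`. -/
noncomputable def nodeInfo (i : V) (k : ℕ) : Matrix (Fin (N.n i)) (Fin (N.n i)) ℝ :=
  N.nodeUpdate (N.msg (k - 1)) i

/-- `Q_{i → i,j}(k)`, `k ≥ 1`. -/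
noncomputable def varMsg (i j : V) (k : ℕ) : Matrix (Fin (N.n i)) (Fin (N.n i)) ℝ :=
  N.varUpdate (N.msg (k - 1)) i j

/-- `R_{i,j → j}(k)`, `k ≥ 1`. -/
noncomputable def covMsg (i j : V) (k : ℕ) :
    Matrix (Fin (N.l s(i, j))) (Fin (N.l s(i, j))) ℝ :=
  N.covUpdate (N.msg (k - 1)) i j

/-- `Q_{i → i,j}(∞)`. -/
noncomputable def varMsgLim (i j : V) : Matrix (Fin (N.n i)) (Fin (N.n i)) ℝ :=
  limUnder atTop (N.varMsg i j)

/-- `R_{i,j → j}(∞)`. -/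
noncomputable def covMsgLim (i j : V) : Matrix (Fin (N.l s(i, j))) (Fin (N.l s(i, j))) ℝ :=
  limUnder atTop (N.covMsg i j)

/-- `ρ = max_{i,j} ‖R_{i,j → j}^{-1/2}(∞) C_{i,j} Q_{i → i,j}⁻¹(∞) C_{i,j}ᵀ R_{i,j → j}^{-1/2}(∞)‖`,
the maximum being over all ordered pairs of adjacent nodes. -/
noncomputable def rho : ℝ :=
  ⨆ p : {p : V × V // N.graph.Adj p.1 p.2},
    spectralNorm₂ (invSqrt (N.covMsgLim p.1.1 p.1.2) *
      (N.jointC s(p.1.1, p.1.2) p.1.1 * (N.varMsgLim p.1.1 p.1.2)⁻¹ *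
        (N.jointC s(p.1.1, p.1.2) p.1.1)ᵀ) * invSqrt (N.covMsgLim p.1.1 p.1.2))

/-- `α = max_{i,j} ‖Q_{i → i,j}^{-1/2}(∞) Ω_{i,j} Q_{i → i,j}^{-1/2}(∞) - I‖`, the maximum being
over all ordered pairs of adjacent nodes. -/
noncomputable def alpha : ℝ :=
  ⨆ p : {p : V × V // N.graph.Adj p.1 p.2},
    spectralNorm₂ (invSqrt (N.varMsgLim p.1.1 p.1.2) * N.omega p.1.1 p.1.2 *
      invSqrt (N.varMsgLim p.1.1 p.1.2) - 1)

/-- The messages `Q_{i → i,j}(k)` converge to positive definite limits, and the matrices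
`R_{i,j → j}(k)` converge, so that `α` and `ρ` are formed from genuine limits. -/
def MessagesConverge : Prop :=
  ∀ i j, N.graph.Adj i j →
    Tendsto (N.varMsg i j) atTop (𝓝 (N.varMsgLim i j)) ∧ (N.varMsgLim i j).PosDef ∧
    Tendsto (N.covMsg i j) atTop (𝓝 (N.covMsgLim i j))

/-! ### Maximum likelihood -/

open Classical in
/-- The joint likelihood `f(X) = ∏_i f_i(x_i) ∏_{(i,j)} f_{i,j}(x_i, x_j)` for the measured values
`z i` and `y e`. For an edge `e = s(i, j)` the sum over `i ∈ e` has the two terms `C_{i,j} x_i` and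
`C_{j,i} x_j`. -/
noncomputable def likelihood (z : (i : V) → Fin (N.m i) → ℝ) (y : (e : Sym2 V) → Fin (N.l e) → ℝ)
    (X : (i : V) → Fin (N.n i) → ℝ) : ℝ :=
  (∏ i, gaussianDensity (N.selfR i) (z i - N.selfC i *ᵥ X i)) *
    ∏ e with e ∈ N.graph.edgeSet,
      gaussianDensity (N.jointR e) (y e - ∑ i with i ∈ e, N.jointC e i *ᵥ X i)

/-- The marginal law of `x_i` under `f`, normalized to a probability measure (when `f` is
integrable). -/
noncomputable def marginalLaw (z : (i : V) → Fin (N.m i) → ℝ)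
    (y : (e : Sym2 V) → Fin (N.l e) → ℝ) (i : V) : Measure (Fin (N.n i) → ℝ) :=
  let μ : Measure ((j : V) → Fin (N.n j) → ℝ) :=
    volume.withDensity fun X => ENNReal.ofReal (N.likelihood z y X)
  (μ Set.univ)⁻¹ • μ.map fun X => X i

/-- `Σ_i^{ML}`, the covariance matrix of `x_i` under its marginal. -/
noncomputable def covML (z : (i : V) → Fin (N.m i) → ℝ)
    (y : (e : Sym2 V) → Fin (N.l e) → ℝ) (i : V) : Matrix (Fin (N.n i)) (Fin (N.n i)) ℝ :=
  Matrix.of fun a b =>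
    ProbabilityTheory.covariance (fun x : Fin (N.n i) → ℝ => x a) (fun x => x b)
      (N.marginalLaw z y i)

/-- `Q_i^{ML} = (Σ_i^{ML})⁻¹`. -/
noncomputable def infoML (z : (i : V) → Fin (N.m i) → ℝ)
    (y : (e : Sym2 V) → Fin (N.l e) → ℝ) (i : V) : Matrix (Fin (N.n i)) (Fin (N.n i)) ℝ :=
  (N.covML z y i)⁻¹

end MeasurementSystem

/-! ### Cycle-free depth and the reduced graph -/

/-- The nodes within `d` hops from `i`. -/
def hopBall {V : Type*} (G : SimpleGraph V) (i : V) (d : ℕ) : Set V :=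
  {v | G.edist i v ≤ d}

/-- The supremum of all `d` for which the subgraph formed by the nodes within `d` hops from `i` is
acyclic; it is `⊤` if all these subgraphs are acyclic. -/
noncomputable def cycleFreeDepth {V : Type*} (G : SimpleGraph V) (i : V) : ℕ∞ :=
  ⨆ (d : ℕ) (_ : (G.induce (hopBall G i d)).IsAcyclic), (d : ℕ∞)

/-- The pairs `(s, u)` of a node `s` outside of the ball of radius `d` around `i` and a node `u` of
this ball adjacent to `s`: they index the copies of the child nodes. -/
def childCopies {V : Type*} (G : SimpleGraph V) (i : V) (d : ℕ) : Set (V × V) :=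
  {p | p.1 ∉ hopBall G i d ∧ p.2 ∈ hopBall G i d ∧ G.Adj p.1 p.2}

/-- The nodes of the reduced graph: the nodes within `d` hops from `i`, and for each child node `s`
one copy `(s, u)` for each neighbour `u` of `s` within `d` hops from `i`. -/
abbrev ReducedNode {V : Type*} (G : SimpleGraph V) (i : V) (d : ℕ) : Type _ :=
  hopBall G i d ⊕ childCopies G i d

noncomputable instance {V : Type*} [Fintype V] (G : SimpleGraph V) (i : V) (d : ℕ) :
    Fintype (ReducedNode G i d) := Fintype.ofFinite _

/-- The node of the original graph of which a node of the reduced graph is a copy. -/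
def reducedProj {V : Type*} (G : SimpleGraph V) (i : V) (d : ℕ) : ReducedNode G i d → V :=
  Sum.elim (fun a => a.1) (fun p => p.1.1)

/-- Adjacency of the reduced graph: nodes of the ball are adjacent as in `G`, and the copy `(s, u)`
is adjacent to `u` only. -/
def reducedAdj {V : Type*} (G : SimpleGraph V) (i : V) (d : ℕ) :
    ReducedNode G i d → ReducedNode G i d → Prop
  | .inl a, .inl b => G.Adj a b
  | .inl a, .inr p => p.1.2 = a
  | .inr p, .inl a => p.1.2 = a
  | .inr _, .inr _ => False

/-- The reduced graph. -/
def reducedGraph {V : Type*} (G : SimpleGraph V) (i : V) (d : ℕ) :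
    SimpleGraph (ReducedNode G i d) where
  Adj := reducedAdj G i d
  symm := ⟨by
    rintro (a | p) (b | q) h
    · exact SimpleGraph.Adj.symm (G := G) h
    · exact h
    · exact h
    · exact h⟩
  loopless := ⟨by
    rintro (a | p) h
    · exact G.loopless.irrefl _ h
    · exact h⟩

/-- The number of copies of a node in the reduced graph: `1` for the nodes of the ball, and the number
of neighbours of `s` in the ball for a copy of the child node `s`. -/
noncomputable def copyCount {V : Type*} (G : SimpleGraph V) (i : V) (d : ℕ) :
    ReducedNode G i d → ℕ
  | .inl _ => 1
  | .inr p => {u | u ∈ hopBall G i d ∧ G.Adj p.1.1 u}.ncard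

theorem copyCount_pos {V : Type*} [Finite V] (G : SimpleGraph V) (i : V) (d : ℕ)
    (a : ReducedNode G i d) : 0 < copyCount G i d a := by
  rcases a with a | p
  · exact one_pos
  · exact (Set.ncard_pos (Set.toFinite _)).2 ⟨p.1.2, p.2.2.1, p.2.2.2⟩

theorem reducedProj_adj {V : Type*} (G : SimpleGraph V) (i : V) (d : ℕ)
    (a b : ReducedNode G i d) (h : (reducedGraph G i d).Adj a b) :
    G.Adj (reducedProj G i d a) (reducedProj G i d b) := by
  rcases a with a | p <;> rcases b with b | q
  · exact h
  · have h' : q.1.2 = a.1 := h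
    have hq : G.Adj q.1.1 q.1.2 := q.2.2.2
    rw [h'] at hq
    exact hq.symm
  · have h' : p.1.2 = b.1 := h
    have hp : G.Adj p.1.1 p.1.2 := p.2.2.2
    rw [h'] at hp
    exact hp
  · exact h.elim

theorem reducedProj_edge {V : Type*} (G : SimpleGraph V) (i : V) (d : ℕ)
    (e : Sym2 (ReducedNode G i d)) (h : e ∈ (reducedGraph G i d).edgeSet) :
    e.map (reducedProj G i d) ∈ G.edgeSet := by
  induction e with
  | h a b => exact reducedProj_adj G i d a b h

/-- The measurement system on the reduced graph: all measurements are copied from the original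
system, except that the noise covariance `R_s` of the self measurement of a child node `s` split
into `p` copies becomes `p R_s` at each copy. -/
noncomputable def MeasurementSystem.reduced {V : Type*} [Fintype V] (N : MeasurementSystem V)
    (i : V) (d : ℕ) : MeasurementSystem (ReducedNode N.graph i d) where
  graph := reducedGraph N.graph i d
  n a := N.n (reducedProj N.graph i d a)
  m a := N.m (reducedProj N.graph i d a)
  l e := N.l (e.map (reducedProj N.graph i d))
  selfC a := N.selfC (reducedProj N.graph i d a)
  selfR a := (copyCount N.graph i d a : ℝ) • N.selfR (reducedProj N.graph i d a)
  jointC e a := N.jointC (e.map (reducedProj N.graph i d)) (reducedProj N.graph i d a)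
  jointR e := N.jointR (e.map (reducedProj N.graph i d))
  selfR_pos a := (N.selfR_pos _).smul (by exact_mod_cast copyCount_pos N.graph i d a)
  jointR_pos e he := N.jointR_pos _ (reducedProj_edge N.graph i d e he)

/-!
The likelihood is a constant times `exp (-E / 2)` up to a shift of the configuration, where the energy
`E` is the sum of the squared norms of all measurements of a configuration. Everything is expressed by
constrained minima of `E`.

* *Maximum likelihood.* Integrability makes `E` positive definite (`energy_pos`): a null vector of `E`
  would be a period of the likelihood, against Poincaré recurrence. In linear coordinates in which `E`
  is the squared norm, the normalized likelihood is a product of one-dimensional Gaussians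
  (`exists_coordinates`), so the covariance of `x_i` is a Gram matrix `A Aᵀ` and `Q_i^{ML}` is the form
  `v ↦ min {E(X) | X i = v}` (`infoML_form_le_energy`, `exists_energy_eq_infoML_form`).
* *Belief propagation.* A message is the Schur complement that eliminates the far end of an edge
  (`form_add_form_eq`). If the ball of radius `d` is a tree, eliminating it level by level
  (`stage_succ`) identifies `Q_i(d)` with the minimum of `E` over the `X` with `X i = v` that vanish at
  distance at least `d` (`exists_energy_eq_nodeInfo_form`). Hence `Q_i(d) ≥ Q_i^{ML}`. If there is
  nothing at distance `d`, then `Q_i(d)` also bounds `E` from below (`nodeInfo_form_le_energy`), and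
  the two are equal.
* *The reduced graph.* It is a tree, so its messages become stationary (`exists_msg_stationary`).
  Copying a configuration to it does not increase the energy, since the `p` copies of a child node
  carry the weight `1 / p` (`energy_reduced_le`); therefore the limit on the reduced graph is at most
  `Q_i^{ML}` (`reduced_form_le_infoML`). On the other hand its first `d` iterations agree at `i` with
  those on the original graph (`nodeInfo_reduced`).
* *The rate.* If the matrices `Q_{i → i,j}` exceed their limits by at most the factor `1 + ε`,
  evaluating the next elimination at the optimal response of the limit shows that the next messages
  exceed theirs by at most `1 + ρ ε` (`form_schur_le_mul`). Starting from `ε = α` this gives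
  `Q_i(d) ≤ (1 + α ρ ^ (d - 1)) Q_i(∞)` on the reduced graph (`nodeUpdate_form_le`).
-/

/-! ### Real quadratic forms -/

section QuadraticForms

theorem transpose_eq_of_isHermitian {ι : Type*} {A : Matrix ι ι ℝ} (h : A.IsHermitian) : Aᵀ = A := by
  rw [← Matrix.conjTranspose_eq_transpose_of_trivial]; exact h

theorem eq_of_posSemidef_sub {ι : Type*} {A B : Matrix ι ι ℝ} (h : (A - B).PosSemidef)
    (h' : (B - A).PosSemidef) : A = B := by
  open scoped MatrixOrder in exact le_antisymm (a := A) (b := B) h' h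

variable {ι κ : Type*} [Fintype ι] [Fintype κ]

theorem dotProduct_mulVec_nonneg {A : Matrix ι ι ℝ} (h : A.PosSemidef) (x : ι → ℝ) :
    0 ≤ x ⬝ᵥ (A *ᵥ x) := by
  simpa using h.dotProduct_mulVec_nonneg x

theorem posSemidef_of_form_nonneg {A : Matrix ι ι ℝ} (h : A.IsHermitian)
    (h' : ∀ x, 0 ≤ x ⬝ᵥ (A *ᵥ x)) : A.PosSemidef :=
  .of_dotProduct_mulVec_nonneg h fun x => by simpa using h' x

theorem dotProduct_mulVec_transpose (A : Matrix ι κ ℝ) (x : ι → ℝ) (y : κ → ℝ) :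
    x ⬝ᵥ (A *ᵥ y) = y ⬝ᵥ (Aᵀ *ᵥ x) := by
  rw [Matrix.dotProduct_mulVec, ← Matrix.mulVec_transpose, dotProduct_comm]

theorem dotProduct_conj_mulVec (A : Matrix ι ι ℝ) (B : Matrix ι κ ℝ) (x : κ → ℝ) :
    x ⬝ᵥ ((Bᵀ * A * B) *ᵥ x) = (B *ᵥ x) ⬝ᵥ (A *ᵥ (B *ᵥ x)) := by
  rw [← Matrix.mulVec_mulVec, ← Matrix.mulVec_mulVec, dotProduct_mulVec_transpose,
    Matrix.transpose_transpose, dotProduct_comm]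

theorem form_add {A : Matrix ι ι ℝ} (h : A.IsHermitian) (x y : ι → ℝ) :
    (x + y) ⬝ᵥ (A *ᵥ (x + y)) = x ⬝ᵥ (A *ᵥ x) + 2 * (x ⬝ᵥ (A *ᵥ y)) + y ⬝ᵥ (A *ᵥ y) := by
  have : y ⬝ᵥ (A *ᵥ x) = x ⬝ᵥ (A *ᵥ y) := by
    rw [dotProduct_mulVec_transpose, transpose_eq_of_isHermitian h]
  rw [Matrix.mulVec_add, dotProduct_add, add_dotProduct, add_dotProduct, this]
  ring

theorem posDef_of_posSemidef_of_ker {A : Matrix ι ι ℝ} (h : A.PosSemidef)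
    (h' : ∀ x, x ⬝ᵥ (A *ᵥ x) = 0 → x = 0) : A.PosDef := by
  refine .of_dotProduct_mulVec_pos h.1 fun x hx => ?_
  have h1 := dotProduct_mulVec_nonneg h x
  simp only [star_trivial]
  exact lt_of_le_of_ne h1 fun h2 => hx (h' x h2.symm)

theorem form_eq_zero_of_posDef {A : Matrix ι ι ℝ} (h : A.PosDef) {x : ι → ℝ}
    (hx : x ⬝ᵥ (A *ᵥ x) = 0) : x = 0 := by
  by_contra hne
  have := h.dotProduct_mulVec_pos hne
  simp only [star_trivial] at this
  exact this.ne' hx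

theorem posSemidef_transpose_mul_mul {A : Matrix ι ι ℝ} (h : A.PosSemidef) (B : Matrix ι κ ℝ) :
    (Bᵀ * A * B).PosSemidef := by
  simpa using h.conjTranspose_mul_mul_same B

theorem posSemidef_mul_mul_transpose {A : Matrix ι ι ℝ} (h : A.PosSemidef) (B : Matrix κ ι ℝ) :
    (B * A * Bᵀ).PosSemidef := by
  simpa using h.mul_mul_conjTranspose_same B

/-! ### Eliminating one end of a joint measurement -/

variable [DecidableEq κ]

theorem posDef_add_conj {R : Matrix ι ι ℝ} {P : Matrix κ κ ℝ} (C : Matrix ι κ ℝ)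
    (hR : R.PosDef) (hP : P.PosDef) : (R + C * P⁻¹ * Cᵀ).PosDef :=
  hR.add_posSemidef (posSemidef_mul_mul_transpose hP.inv.posSemidef C)

variable [DecidableEq ι]

theorem posDef_mul_inv {A : Matrix ι ι ℝ} (h : A.PosDef) : A * A⁻¹ = 1 :=
  Matrix.mul_nonsing_inv _ ((Matrix.isUnit_iff_isUnit_det _).1 h.isUnit)

theorem posDef_inv_mul {A : Matrix ι ι ℝ} (h : A.PosDef) : A⁻¹ * A = 1 :=
  Matrix.nonsing_inv_mul _ ((Matrix.isUnit_iff_isUnit_det _).1 h.isUnit)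

/-- The minimizer over `x` of `‖y + C x‖²_{R⁻¹} + xᵀ P x`. -/
noncomputable def optResponse (R : Matrix ι ι ℝ) (P : Matrix κ κ ℝ) (C : Matrix ι κ ℝ) (y : ι → ℝ) :
    κ → ℝ :=
  -(P⁻¹ *ᵥ (Cᵀ *ᵥ ((R + C * P⁻¹ * Cᵀ)⁻¹ *ᵥ y)))

/-- Completing the square: the two quadratic terms in which `x` occurs split into the Schur
complement in `y` and a nonnegative form in the deviation of `x` from the optimal response. -/
theorem form_add_form_eq {R : Matrix ι ι ℝ} {P : Matrix κ κ ℝ} (C : Matrix ι κ ℝ)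
    (hR : R.PosDef) (hP : P.PosDef) (y : ι → ℝ) (x : κ → ℝ) :
    (y + C *ᵥ x) ⬝ᵥ (R⁻¹ *ᵥ (y + C *ᵥ x)) + x ⬝ᵥ (P *ᵥ x) =
      y ⬝ᵥ ((R + C * P⁻¹ * Cᵀ)⁻¹ *ᵥ y) +
        ((C *ᵥ (x - optResponse R P C y)) ⬝ᵥ (R⁻¹ *ᵥ (C *ᵥ (x - optResponse R P C y))) +
        (x - optResponse R P C y) ⬝ᵥ (P *ᵥ (x - optResponse R P C y))) := by
  have hS := posDef_add_conj C hR hP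
  set S := R + C * P⁻¹ * Cᵀ with hSdef
  set u := S⁻¹ *ᵥ y with hu
  set w := P⁻¹ *ᵥ (Cᵀ *ᵥ u) with hw
  have ho : optResponse R P C y = -w := rfl
  set δ := x - optResponse R P C y with hδ
  have hx : x = δ + -w := by rw [hδ, ho]; abel
  have hy : y = R *ᵥ u + C *ᵥ w := by
    have : S *ᵥ u = y := by rw [hu, Matrix.mulVec_mulVec, posDef_mul_inv hS, Matrix.one_mulVec]
    rw [← this, hSdef, Matrix.add_mulVec, hw]
    simp only [Matrix.mulVec_mulVec, Matrix.mul_assoc]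
  have hyx : y + C *ᵥ x = R *ᵥ u + C *ᵥ δ := by
    rw [hx, hy, Matrix.mulVec_add, Matrix.mulVec_neg]; abel
  have hPw : P *ᵥ w = Cᵀ *ᵥ u := by
    rw [hw, Matrix.mulVec_mulVec, posDef_mul_inv hP, Matrix.one_mulVec]
  have hRu : R⁻¹ *ᵥ (R *ᵥ u) = u := by
    rw [Matrix.mulVec_mulVec, posDef_inv_mul hR, Matrix.one_mulVec]
  have e1 : (R *ᵥ u) ⬝ᵥ (R⁻¹ *ᵥ (C *ᵥ δ)) = u ⬝ᵥ (C *ᵥ δ) := by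
    rw [dotProduct_mulVec_transpose, transpose_eq_of_isHermitian hR.inv.1, hRu, dotProduct_comm]
  have e2 : (R *ᵥ u) ⬝ᵥ (R⁻¹ *ᵥ (R *ᵥ u)) = u ⬝ᵥ (R *ᵥ u) := by rw [hRu, dotProduct_comm]
  have e3 : δ ⬝ᵥ (P *ᵥ w) = u ⬝ᵥ (C *ᵥ δ) := by
    rw [hPw, dotProduct_mulVec_transpose, Matrix.transpose_transpose]
  have e4 : w ⬝ᵥ (P *ᵥ w) = u ⬝ᵥ (C *ᵥ w) := by
    rw [hPw, dotProduct_mulVec_transpose, Matrix.transpose_transpose]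
  have e5 : y ⬝ᵥ u = u ⬝ᵥ (R *ᵥ u) + u ⬝ᵥ (C *ᵥ w) := by
    rw [dotProduct_comm, ← dotProduct_add, ← hy]
  rw [hyx, form_add hR.inv.1, hx, form_add hP.1, e1, e2, e5, Matrix.mulVec_neg, neg_dotProduct_neg,
    dotProduct_neg, e3, e4]
  ring

theorem form_schur_le {R : Matrix ι ι ℝ} {P : Matrix κ κ ℝ} (C : Matrix ι κ ℝ)
    (hR : R.PosDef) (hP : P.PosDef) (y : ι → ℝ) (x : κ → ℝ) :
    y ⬝ᵥ ((R + C * P⁻¹ * Cᵀ)⁻¹ *ᵥ y) ≤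
      (y + C *ᵥ x) ⬝ᵥ (R⁻¹ *ᵥ (y + C *ᵥ x)) + x ⬝ᵥ (P *ᵥ x) := by
  rw [form_add_form_eq C hR hP]
  have h1 := dotProduct_mulVec_nonneg hR.inv.posSemidef (C *ᵥ (x - optResponse R P C y))
  have h2 := dotProduct_mulVec_nonneg hP.posSemidef (x - optResponse R P C y)
  linarith

theorem form_schur_eq {R : Matrix ι ι ℝ} {P : Matrix κ κ ℝ} (C : Matrix ι κ ℝ)
    (hR : R.PosDef) (hP : P.PosDef) (y : ι → ℝ) :
    y ⬝ᵥ ((R + C * P⁻¹ * Cᵀ)⁻¹ *ᵥ y) =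
      (y + C *ᵥ optResponse R P C y) ⬝ᵥ (R⁻¹ *ᵥ (y + C *ᵥ optResponse R P C y)) +
        optResponse R P C y ⬝ᵥ (P *ᵥ optResponse R P C y) := by
  rw [form_add_form_eq C hR hP]
  simp

/-- The share of `xᵀ P x` in the minimum is `uᵀ (C P⁻¹ Cᵀ) u` with `u = S⁻¹ y`. -/
theorem form_optResponse {R : Matrix ι ι ℝ} {P : Matrix κ κ ℝ} (C : Matrix ι κ ℝ)
    (hP : P.PosDef) (y : ι → ℝ) :
    optResponse R P C y ⬝ᵥ (P *ᵥ optResponse R P C y) =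
      ((R + C * P⁻¹ * Cᵀ)⁻¹ *ᵥ y) ⬝ᵥ ((C * P⁻¹ * Cᵀ) *ᵥ ((R + C * P⁻¹ * Cᵀ)⁻¹ *ᵥ y)) := by
  set u := (R + C * P⁻¹ * Cᵀ)⁻¹ *ᵥ y with hu
  have ho : optResponse R P C y = -(P⁻¹ *ᵥ (Cᵀ *ᵥ u)) := rfl
  have := dotProduct_conj_mulVec P⁻¹ Cᵀ u
  rw [Matrix.transpose_transpose] at this
  rw [this, ho, Matrix.mulVec_neg, neg_dotProduct_neg, Matrix.mulVec_mulVec (M := P),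
    posDef_mul_inv hP, Matrix.one_mulVec, dotProduct_comm]

/-- If `P' ≤ (1 + ε) P` and the part `C P⁻¹ Cᵀ` of `S = R + C P⁻¹ Cᵀ` is at most `ρ S`, then the
Schur complement formed with `P'` is at most `1 + ρ ε` times the one formed with `P`. -/
theorem form_schur_le_mul {R : Matrix ι ι ℝ} {P P' : Matrix κ κ ℝ} (C : Matrix ι κ ℝ)
    (hR : R.PosDef) (hP : P.PosDef) (hP' : P'.PosDef) {ε ρ : ℝ} (hε : 0 ≤ ε)
    (h : ∀ x, x ⬝ᵥ (P' *ᵥ x) ≤ (1 + ε) * (x ⬝ᵥ (P *ᵥ x)))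
    (hρ : ∀ u, u ⬝ᵥ ((C * P⁻¹ * Cᵀ) *ᵥ u) ≤ ρ * (u ⬝ᵥ ((R + C * P⁻¹ * Cᵀ) *ᵥ u)))
    (y : ι → ℝ) :
    y ⬝ᵥ ((R + C * P'⁻¹ * Cᵀ)⁻¹ *ᵥ y) ≤
      (1 + ρ * ε) * (y ⬝ᵥ ((R + C * P⁻¹ * Cᵀ)⁻¹ *ᵥ y)) := by
  have h1 := form_schur_le C hR hP' y (optResponse R P C y)
  have h2 := form_schur_eq C hR hP y
  have h3 := h (optResponse R P C y)
  have h4 := hρ ((R + C * P⁻¹ * Cᵀ)⁻¹ *ᵥ y)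
  rw [← form_optResponse C hP, Matrix.mulVec_mulVec, posDef_mul_inv (posDef_add_conj C hR hP),
    Matrix.one_mulVec, dotProduct_comm _ y] at h4
  have h5 := mul_le_mul_of_nonneg_left h4 hε
  linarith

end QuadraticForms

/-! ### Spectral norms -/

section SpectralNorm

variable {k : ℕ}

theorem isHermitian_invSqrt (Q : Matrix (Fin k) (Fin k) ℝ) : (invSqrt Q).IsHermitian := by
  open scoped MatrixOrder in
  exact (Matrix.nonneg_iff_posSemidef.1 (CFC.sqrt_nonneg Q⁻¹)).1

theorem invSqrt_mul_self {Q : Matrix (Fin k) (Fin k) ℝ} (h : Q.PosDef) :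
    invSqrt Q * invSqrt Q = Q⁻¹ := by
  open scoped MatrixOrder in
  exact CFC.sqrt_mul_sqrt_self Q⁻¹ (Matrix.nonneg_iff_posSemidef.2 h.inv.posSemidef)

theorem abs_form_le_spectralNorm (A : Matrix (Fin k) (Fin k) ℝ) (x : Fin k → ℝ) :
    |x ⬝ᵥ (A *ᵥ x)| ≤ spectralNorm₂ A * (x ⬝ᵥ x) := by
  have h1 := abs_real_inner_le_norm (WithLp.toLp 2 x)
    (Matrix.toEuclideanCLM (n := Fin k) (𝕜 := ℝ) A (WithLp.toLp 2 x))
  have h2 := (Matrix.toEuclideanCLM (n := Fin k) (𝕜 := ℝ) A).le_opNorm (WithLp.toLp 2 x)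
  have h3 : inner ℝ (WithLp.toLp 2 x)
    (Matrix.toEuclideanCLM (n := Fin k) (𝕜 := ℝ) A (WithLp.toLp 2 x)) = x ⬝ᵥ (A *ᵥ x) := by
    rw [Matrix.toEuclideanCLM_toLp, EuclideanSpace.inner_toLp_toLp, dotProduct_comm]; simp
  have h4 : ‖WithLp.toLp 2 x‖ * ‖WithLp.toLp 2 x‖ = x ⬝ᵥ x := by
    rw [← real_inner_self_eq_norm_mul_norm, EuclideanSpace.inner_toLp_toLp]; simp
  rw [h3] at h1
  calc _ ≤ _ := h1
    _ ≤ ‖WithLp.toLp 2 x‖ * (_ * ‖WithLp.toLp 2 x‖) := by gcongr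
    _ = _ := by rw [← h4, spectralNorm₂]; ring

/-- `x = Q^{-1/2} z` has a solution `z`, of square length `xᵀ Q x`. -/
theorem exists_invSqrt_mulVec {Q : Matrix (Fin k) (Fin k) ℝ} (h : Q.PosDef) (x : Fin k → ℝ) :
    ∃ z, invSqrt Q *ᵥ z = x ∧ z ⬝ᵥ z = x ⬝ᵥ (Q *ᵥ x) := by
  have h1 : invSqrt Q *ᵥ (invSqrt Q *ᵥ (Q *ᵥ x)) = x := by
    rw [Matrix.mulVec_mulVec, Matrix.mulVec_mulVec, invSqrt_mul_self h, posDef_inv_mul h,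
      Matrix.one_mulVec]
  refine ⟨invSqrt Q *ᵥ (Q *ᵥ x), h1, ?_⟩
  rw [dotProduct_mulVec_transpose, transpose_eq_of_isHermitian (isHermitian_invSqrt Q), h1,
    dotProduct_comm]

theorem form_invSqrt_conj (Q A : Matrix (Fin k) (Fin k) ℝ) (z : Fin k → ℝ) :
    z ⬝ᵥ ((invSqrt Q * A * invSqrt Q) *ᵥ z) =
      (invSqrt Q *ᵥ z) ⬝ᵥ (A *ᵥ (invSqrt Q *ᵥ z)) := by
  have := dotProduct_conj_mulVec A (invSqrt Q) z
  rwa [transpose_eq_of_isHermitian (isHermitian_invSqrt Q)] at this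

theorem form_le_of_spectralNorm_le {S W : Matrix (Fin k) (Fin k) ℝ} (hS : S.PosDef) {ρ : ℝ}
    (h : spectralNorm₂ (invSqrt S * W * invSqrt S) ≤ ρ) (u : Fin k → ℝ) :
    u ⬝ᵥ (W *ᵥ u) ≤ ρ * (u ⬝ᵥ (S *ᵥ u)) := by
  obtain ⟨z, rfl, hz⟩ := exists_invSqrt_mulVec hS u
  rw [← hz, ← form_invSqrt_conj]
  refine (le_abs_self _).trans ((abs_form_le_spectralNorm _ _).trans ?_)
  have : 0 ≤ z ⬝ᵥ z := by simpa using dotProduct_star_self_nonneg z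
  gcongr

theorem form_le_of_spectralNorm_sub_one_le {Q A : Matrix (Fin k) (Fin k) ℝ} (hQ : Q.PosDef)
    {α : ℝ} (h : spectralNorm₂ (invSqrt Q * A * invSqrt Q - 1) ≤ α) (x : Fin k → ℝ) :
    x ⬝ᵥ (A *ᵥ x) ≤ (1 + α) * (x ⬝ᵥ (Q *ᵥ x)) := by
  obtain ⟨z, rfl, hz⟩ := exists_invSqrt_mulVec hQ x
  rw [← hz, ← form_invSqrt_conj]
  have h1 := (le_abs_self _).trans (abs_form_le_spectralNorm (invSqrt Q * A * invSqrt Q - 1) z)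
  rw [Matrix.sub_mulVec, Matrix.one_mulVec, dotProduct_sub] at h1
  have h0 : 0 ≤ z ⬝ᵥ z := by simpa using dotProduct_star_self_nonneg z
  have := mul_le_mul_of_nonneg_right h h0
  linarith

/-- A positive semidefinite matrix that is strictly below the identity is a strict contraction. -/
theorem spectralNorm_lt_one {A : Matrix (Fin k) (Fin k) ℝ} (hA : A.PosSemidef)
    (h : (1 - A).PosDef) : spectralNorm₂ A < 1 := by
  have h1 : ∀ x : Fin k → ℝ, x ≠ 0 → (A *ᵥ x) ⬝ᵥ (A *ᵥ x) < x ⬝ᵥ x := by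
    intro x hx
    -- `1 - A² = (1 - A) + (1 - A) A (1 - A) + A (1 - A) A`
    have e : 1 - A * A = (1 - A) + (1 - A)ᵀ * A * (1 - A) + Aᵀ * (1 - A) * A := by
      rw [transpose_eq_of_isHermitian hA.1, transpose_eq_of_isHermitian h.1]; noncomm_ring
    have hp : (1 - A * A).PosDef := by
      rw [e]
      exact (h.add_posSemidef (posSemidef_transpose_mul_mul hA _)).add_posSemidef
        (posSemidef_transpose_mul_mul h.posSemidef _)
    have := hp.dotProduct_mulVec_pos hx
    rw [star_trivial, Matrix.sub_mulVec, Matrix.one_mulVec, dotProduct_sub, ← Matrix.mulVec_mulVec,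
      dotProduct_mulVec_transpose, transpose_eq_of_isHermitian hA.1] at this
    linarith
  set T := Matrix.toEuclideanCLM (n := Fin k) (𝕜 := ℝ) A with hT
  have hT1 : ∀ x, x ≠ 0 → ‖T x‖ < ‖x‖ := by
    intro x hx
    have hx' : WithLp.ofLp x ≠ 0 := by simpa using hx
    have h2 := h1 _ hx'
    have n1 : ‖x‖ ^ 2 = WithLp.ofLp x ⬝ᵥ WithLp.ofLp x := by
      rw [EuclideanSpace.norm_sq_eq]; simp [dotProduct, sq]
    have n2 : ‖T x‖ ^ 2 = (A *ᵥ WithLp.ofLp x) ⬝ᵥ (A *ᵥ WithLp.ofLp x) := by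
      rw [EuclideanSpace.norm_sq_eq]; simp [dotProduct, sq, hT]
    rw [← n1, ← n2] at h2
    exact lt_of_pow_lt_pow_left₀ 2 (norm_nonneg _) h2
  change ‖T‖ < 1
  rcases Nat.eq_zero_or_pos k with rfl | hk
  · have : T = 0 := by ext x i; exact i.elim0
    rw [this]; simp
  -- the norm is attained on the compact unit sphere
  have hne : Nontrivial (EuclideanSpace ℝ (Fin k)) := by
    have : Nonempty (Fin k) := ⟨⟨0, hk⟩⟩
    infer_instance
  obtain ⟨x, hx, hmax⟩ := (isCompact_sphere (0 : EuclideanSpace ℝ (Fin k)) 1).exists_isMaxOn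
    (NormedSpace.sphere_nonempty.2 zero_le_one) (T.continuous.norm.continuousOn)
  have hx1 : ‖x‖ = 1 := by simpa using hx
  have hx0 : x ≠ 0 := by rintro rfl; simp at hx1
  refine lt_of_le_of_lt (T.opNorm_le_of_unit_norm (norm_nonneg (T x)) fun y hy => ?_)
    ((hT1 x hx0).trans_eq hx1)
  exact hmax (by simpa using hy)

theorem spectralNorm_schur_lt_one {R W : Matrix (Fin k) (Fin k) ℝ} (hR : R.PosDef)
    (hW : W.PosSemidef) :
    spectralNorm₂ (invSqrt (R + W) * W * invSqrt (R + W)) < 1 := by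
  have hS : (R + W).PosDef := hR.add_posSemidef hW
  set T := invSqrt (R + W) with hT
  have hTt : Tᵀ = T := transpose_eq_of_isHermitian (isHermitian_invSqrt _)
  have hTT : T * T = (R + W)⁻¹ := invSqrt_mul_self hS
  have e1 : T * (T * (R + W)) = 1 := by rw [← Matrix.mul_assoc, hTT, posDef_inv_mul hS]
  have e2 : T * (R + W) * T = 1 := by
    exact mul_eq_one_comm.1 e1
  have e3 : 1 - T * W * T = T * R * T := by
    rw [← e2]; noncomm_ring
  refine spectralNorm_lt_one ?_ ?_
  · have := posSemidef_transpose_mul_mul hW T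
    rwa [hTt] at this
  · rw [e3]
    refine posDef_of_posSemidef_of_ker ?_ fun x hx => ?_
    · have := posSemidef_transpose_mul_mul hR.posSemidef T
      rwa [hTt] at this
    · rw [hT, form_invSqrt_conj] at hx
      have h0 := form_eq_zero_of_posDef hR hx
      have : (T * (R + W) * T) *ᵥ x = 0 := by
        rw [← Matrix.mulVec_mulVec, hT, h0, Matrix.mulVec_zero]
      rwa [e2, Matrix.one_mulVec] at this

end SpectralNorm

/-! ### Positivity of the messages and the energy of a configuration -/

theorem form_sum {ι κ : Type*} [Fintype ι] (s : Finset κ) (A : κ → Matrix ι ι ℝ) (x : ι → ℝ) :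
    x ⬝ᵥ ((∑ j ∈ s, A j) *ᵥ x) = ∑ j ∈ s, x ⬝ᵥ (A j *ᵥ x) := by
  rw [Matrix.sum_mulVec, dotProduct_sum]

namespace MeasurementSystem

variable {V : Type*} [Fintype V] (N : MeasurementSystem V)

omit [Fintype V] in
theorem posSemidef_selfInfo (i : V) : (N.selfInfo i).PosSemidef :=
  posSemidef_transpose_mul_mul (N.selfR_pos i).inv.posSemidef _

omit [Fintype V] in
theorem jointR_posDef {i j : V} (h : N.graph.Adj i j) : (N.jointR s(i, j)).PosDef :=
  N.jointR_pos _ h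

omit [Fintype V] in
theorem posSemidef_jointInfo {i j : V} (h : N.graph.Adj i j) : (N.jointInfo i j).PosSemidef :=
  posSemidef_transpose_mul_mul (N.jointR_posDef h).inv.posSemidef _

omit [Fintype V] in
theorem jointInfo_eq_swap (i j : V) : N.jointInfo i j =
    (N.jointC s(j, i) i)ᵀ * (N.jointR s(j, i))⁻¹ * N.jointC s(j, i) i := by
  rw [jointInfo, Sym2.eq_swap]

open Classical in
theorem varUpdate_eq (M : (i j : V) → Matrix (Fin (N.n i)) (Fin (N.n i)) ℝ) {i j : V}
    (h : N.graph.Adj i j) :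
    N.varUpdate M i j = N.selfInfo i + ∑ w with N.graph.Adj i w ∧ w ≠ j, M i w := by
  have h1 : (Finset.univ.filter fun w => N.graph.Adj i w) =
      insert j (Finset.univ.filter fun w => N.graph.Adj i w ∧ w ≠ j) := by
    ext w
    by_cases hw : w = j <;> simp [hw, h]
  rw [varUpdate, nodeUpdate, h1, Finset.sum_insert (by simp)]
  abel

theorem varUpdate_msg_zero {i j : V} (h : N.graph.Adj i j) :
    N.varUpdate (N.msg 0) i j = N.omega i j :=
  N.varUpdate_eq _ h

variable {N} in
theorem Dominance.omegaPos (h : N.Dominance) : N.OmegaPos := fun i j hij => by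
  have := (h i j hij).add_posSemidef (N.posSemidef_jointInfo hij)
  rwa [sub_add_cancel] at this

theorem posDef_covUpdate {M : (i j : V) → Matrix (Fin (N.n i)) (Fin (N.n i)) ℝ} {i j : V}
    (hij : N.graph.Adj i j) (h : (N.varUpdate M i j).PosDef) : (N.covUpdate M i j).PosDef :=
  posDef_add_conj _ (N.jointR_posDef hij) h

theorem posDef_varUpdate_of_ker (hΩ : N.OmegaPos)
    {M : (i j : V) → Matrix (Fin (N.n i)) (Fin (N.n i)) ℝ}
    (h : ∀ i j, N.graph.Adj i j → (M i j).PosSemidef ∧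
      ∀ x, x ⬝ᵥ (M i j *ᵥ x) = 0 → x ⬝ᵥ (N.jointInfo i j *ᵥ x) = 0)
    {i j : V} (hij : N.graph.Adj i j) : (N.varUpdate M i j).PosDef := by
  classical
  rw [N.varUpdate_eq _ hij]
  refine posDef_of_posSemidef_of_ker ((N.posSemidef_selfInfo i).add
    (Matrix.posSemidef_sum _ fun w hw => (h i w (Finset.mem_filter.1 hw).2.1).1)) fun x hx => ?_
  rw [Matrix.add_mulVec, dotProduct_add, form_sum] at hx
  have h0 := dotProduct_mulVec_nonneg (N.posSemidef_selfInfo i) x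
  have h1 : ∀ w ∈ Finset.univ.filter (fun w => N.graph.Adj i w ∧ w ≠ j), 0 ≤ x ⬝ᵥ (M i w *ᵥ x) :=
    fun w hw => dotProduct_mulVec_nonneg (h i w (Finset.mem_filter.1 hw).2.1).1 x
  have h2 := Finset.sum_nonneg h1
  have h3 := (Finset.sum_eq_zero_iff_of_nonneg h1).1 (by linarith)
  refine form_eq_zero_of_posDef (hΩ i j hij) ?_
  rw [omega, Matrix.add_mulVec, dotProduct_add, form_sum]
  rw [show x ⬝ᵥ (N.selfInfo i *ᵥ x) = 0 by linarith, zero_add]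
  exact Finset.sum_eq_zero fun w hw =>
    (h i w (Finset.mem_filter.1 hw).2.1).2 x (h3 w hw)

/-- Every message is positive semidefinite with the same kernel as `C_{i,j}ᵀ R_{i,j}⁻¹ C_{i,j}`. This
is why `Ω > 0` keeps all matrices that are inverted positive definite. -/
theorem posSemidef_msg_and_ker (hΩ : N.OmegaPos) (k : ℕ) (i j : V) (hij : N.graph.Adj i j) :
    (N.msg k i j).PosSemidef ∧
      ∀ x, x ⬝ᵥ (N.msg k i j *ᵥ x) = 0 → x ⬝ᵥ (N.jointInfo i j *ᵥ x) = 0 := by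
  induction k generalizing i j with
  | zero => exact ⟨N.posSemidef_jointInfo hij, fun x hx => hx⟩
  | succ k ih =>
    have hS : (N.covUpdate (N.msg k) j i).PosDef :=
      N.posDef_covUpdate hij.symm (N.posDef_varUpdate_of_ker hΩ ih hij.symm)
    refine ⟨posSemidef_transpose_mul_mul hS.inv.posSemidef _, fun x hx => ?_⟩
    rw [msg, dotProduct_conj_mulVec] at hx
    rw [jointInfo_eq_swap, dotProduct_conj_mulVec, form_eq_zero_of_posDef hS.inv hx]
    simp

theorem posDef_varUpdate_msg (hΩ : N.OmegaPos) (k : ℕ) {i j : V} (hij : N.graph.Adj i j) :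
    (N.varUpdate (N.msg k) i j).PosDef :=
  N.posDef_varUpdate_of_ker hΩ (N.posSemidef_msg_and_ker hΩ k) hij

theorem posSemidef_msg (hΩ : N.OmegaPos) (k : ℕ) {i j : V} (hij : N.graph.Adj i j) :
    (N.msg k i j).PosSemidef :=
  (N.posSemidef_msg_and_ker hΩ k i j hij).1

theorem posSemidef_nodeUpdate_msg (hΩ : N.OmegaPos) (k : ℕ) (i : V) :
    (N.nodeUpdate (N.msg k) i).PosSemidef := by
  classical
  exact (N.posSemidef_selfInfo i).add
    (Matrix.posSemidef_sum _ fun w hw => N.posSemidef_msg hΩ k (Finset.mem_filter.1 hw).2)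

open Classical in
/-- The residual `∑_{i ∈ e} C_{e,i} x_i` of the joint measurement `e`, for measured value `0`. -/
noncomputable def edgeValue (e : Sym2 V) (X : (i : V) → Fin (N.n i) → ℝ) : Fin (N.l e) → ℝ :=
  ∑ i with i ∈ e, N.jointC e i *ᵥ X i

/-- The energy `‖∑_{i ∈ e} C_{e,i} x_i‖²` of an edge in the norm given by `R_e⁻¹`. -/
noncomputable def edgeEnergy (e : Sym2 V) (X : (i : V) → Fin (N.n i) → ℝ) : ℝ :=
  N.edgeValue e X ⬝ᵥ ((N.jointR e)⁻¹ *ᵥ N.edgeValue e X)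

/-- The energy `‖C_i x‖²` of a state of the node `i` in the norm given by `R_i⁻¹`. -/
noncomputable def selfEnergy (i : V) (x : Fin (N.n i) → ℝ) : ℝ :=
  x ⬝ᵥ (N.selfInfo i *ᵥ x)

open Classical in
/-- The energy of a configuration: the likelihood for measured values `0` is a constant multiple of
`exp (-energy / 2)`, so that this is the quadratic form of the joint information matrix. -/
noncomputable def energy (X : (i : V) → Fin (N.n i) → ℝ) : ℝ :=
  ∑ i, N.selfEnergy i (X i) + ∑ e with e ∈ N.graph.edgeSet, N.edgeEnergy e X

theorem edgeValue_mk {i j : V} (h : i ≠ j) (X : (i : V) → Fin (N.n i) → ℝ) :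
    N.edgeValue s(i, j) X = N.jointC s(i, j) i *ᵥ X i + N.jointC s(i, j) j *ᵥ X j := by
  classical
  rw [edgeValue, show (Finset.univ.filter fun w => w ∈ s(i, j)) = {i, j} by ext; simp,
    Finset.sum_pair h]

omit [Fintype V] in
theorem selfEnergy_nonneg (i : V) (x : Fin (N.n i) → ℝ) : 0 ≤ N.selfEnergy i x :=
  dotProduct_mulVec_nonneg (N.posSemidef_selfInfo i) x

theorem edgeEnergy_nonneg {e : Sym2 V} (he : e ∈ N.graph.edgeSet)
    (X : (i : V) → Fin (N.n i) → ℝ) : 0 ≤ N.edgeEnergy e X :=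
  dotProduct_mulVec_nonneg (N.jointR_pos e he).inv.posSemidef _

/-- The quadratic form of a message `Q_{i,j → i}(k)` at the state of `i`. -/
noncomputable def msgForm (k : ℕ) (i j : V) (X : (i : V) → Fin (N.n i) → ℝ) : ℝ :=
  X i ⬝ᵥ (N.msg k i j *ᵥ X i)

/-- The optimal response of the node `j` to the state `x` of its neighbour `i`, when the rest of the
graph is summarized by the messages after `k` iterations. -/
noncomputable def response (k : ℕ) (i j : V) (x : Fin (N.n i) → ℝ) : Fin (N.n j) → ℝ :=
  optResponse (N.jointR s(j, i)) (N.varUpdate (N.msg k) j i) (N.jointC s(j, i) j)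
    (N.jointC s(j, i) i *ᵥ x)

theorem msgForm_succ (k : ℕ) (i j : V) (X : (i : V) → Fin (N.n i) → ℝ) :
    N.msgForm (k + 1) i j X = (N.jointC s(j, i) i *ᵥ X i) ⬝ᵥ
      ((N.covUpdate (N.msg k) j i)⁻¹ *ᵥ (N.jointC s(j, i) i *ᵥ X i)) := by
  rw [msgForm, msg, dotProduct_conj_mulVec]

theorem msgForm_zero {i j : V} (hij : N.graph.Adj i j) {X : (i : V) → Fin (N.n i) → ℝ}
    (hX : X j = 0) : N.msgForm 0 i j X = N.edgeEnergy s(j, i) X := by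
  have h0 : N.msg 0 i j = N.jointInfo i j := rfl
  rw [msgForm, h0, jointInfo_eq_swap, dotProduct_conj_mulVec, edgeEnergy,
    N.edgeValue_mk hij.ne', hX, Matrix.mulVec_zero, zero_add]

/-- A message bounds from below the cost of the edge plus the cost of what lies behind it. -/
theorem msgForm_succ_le (hΩ : N.OmegaPos) (k : ℕ) {i j : V} (hij : N.graph.Adj i j)
    (X : (i : V) → Fin (N.n i) → ℝ) :
    N.msgForm (k + 1) i j X ≤
      N.edgeEnergy s(j, i) X + X j ⬝ᵥ (N.varUpdate (N.msg k) j i *ᵥ X j) := by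
  rw [msgForm_succ, edgeEnergy, N.edgeValue_mk hij.ne', add_comm (N.jointC s(j, i) j *ᵥ X j)]
  exact form_schur_le _ (N.jointR_posDef hij.symm) (N.posDef_varUpdate_msg hΩ k hij.symm) _ _

theorem msgForm_succ_eq (hΩ : N.OmegaPos) (k : ℕ) {i j : V} (hij : N.graph.Adj i j)
    {X : (i : V) → Fin (N.n i) → ℝ} (hX : X j = N.response k i j (X i)) :
    N.msgForm (k + 1) i j X =
      N.edgeEnergy s(j, i) X + X j ⬝ᵥ (N.varUpdate (N.msg k) j i *ᵥ X j) := by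
  rw [msgForm_succ, edgeEnergy, N.edgeValue_mk hij.ne', add_comm (N.jointC s(j, i) j *ᵥ X j), hX]
  exact form_schur_eq _ (N.jointR_posDef hij.symm) (N.posDef_varUpdate_msg hΩ k hij.symm) _

end MeasurementSystem

/-! ### Elimination of a rooted tree, level by level -/

/-- The nodes of level at most `d` form a tree with root `r`, level function `h` and parent function
`par`: a node of level at most `d` has its parent as only neighbour that is not one level deeper.
Nodes beyond level `d` are unconstrained. -/
structure IsRootedUpTo {V : Type*} (G : SimpleGraph V) (r : V) (d : ℕ) (h : V → ℕ) (par : V → V) :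
    Prop where
  level_eq_zero : ∀ w, h w = 0 ↔ w = r
  adj_par : ∀ w, 0 < h w → h w ≤ d → G.Adj w (par w) ∧ h (par w) + 1 = h w
  of_adj : ∀ w u, h w ≤ d → G.Adj w u → h u = h w + 1 ∨ (0 < h w ∧ u = par w)

namespace IsRootedUpTo

variable {V : Type*} {G : SimpleGraph V} {r : V} {d : ℕ} {h : V → ℕ} {par : V → V}
  (T : IsRootedUpTo G r d h par)

include T

theorem level_root : h r = 0 := (T.level_eq_zero r).2 rfl

theorem adj_par' {w : V} (h0 : 0 < h w) (hd : h w ≤ d) : G.Adj w (par w) :=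
  (T.adj_par w h0 hd).1

theorem level_par {w : V} (h0 : 0 < h w) (hd : h w ≤ d) : h (par w) + 1 = h w :=
  (T.adj_par w h0 hd).2

theorem adj_deeper_iff {w u : V} (hw : h w + 1 ≤ d) :
    (G.Adj w u ∧ h u = h w + 1) ↔ (h u = h w + 1 ∧ par u = w) := by
  constructor
  · rintro ⟨h1, h2⟩
    refine ⟨h2, ?_⟩
    rcases T.of_adj u w (by omega) h1.symm with h3 | h3
    · omega
    · exact h3.2.symm
  · rintro ⟨h1, rfl⟩
    exact ⟨(T.adj_par' (by omega) (by omega)).symm, h1⟩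

theorem adj_ne_par_iff {w u : V} (h0 : 0 < h w) (hw : h w + 1 ≤ d) :
    (G.Adj w u ∧ u ≠ par w) ↔ (h u = h w + 1 ∧ par u = w) := by
  rw [← T.adj_deeper_iff hw]
  refine and_congr_right fun h1 => ⟨fun h2 => ?_, fun h2 => ?_⟩
  · rcases T.of_adj w u (by omega) h1 with h3 | h3
    · exact h3
    · exact absurd h3.2 h2
  · rintro rfl
    have := T.level_par h0 (by omega)
    omega

theorem adj_root_iff {u : V} (hd : 1 ≤ d) : G.Adj r u ↔ (h u = 1 ∧ par u = r) := by
  have hr := T.level_root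
  have := T.adj_deeper_iff (w := r) (u := u) (by omega)
  rw [hr, zero_add] at this
  rw [← this]
  refine ⟨fun h1 => ⟨h1, ?_⟩, fun h1 => h1.1⟩
  rcases T.of_adj r u (by omega) h1 with h3 | h3
  · omega
  · omega

theorem parentEdge_injOn : Set.InjOn (fun w => s(w, par w)) {w | 0 < h w ∧ h w ≤ d} := by
  rintro w ⟨hw, hw'⟩ u ⟨hu, hu'⟩ he
  have h1 := T.level_par hw hw'
  have h2 := T.level_par hu hu'
  rcases Sym2.eq_iff.1 he with h3 | ⟨h3, h4⟩
  · exact h3.1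
  · rw [h4] at h1; rw [← h3] at h2; omega

end IsRootedUpTo

namespace MeasurementSystem

variable {V : Type*} [Fintype V] (N : MeasurementSystem V)

/-- The energy of the nodes and edges up to level `t`, plus the messages `Q(k)` from level `t + 1` to
level `t`. -/
noncomputable def stage (h : V → ℕ) (par : V → V) (t k : ℕ) (X : (i : V) → Fin (N.n i) → ℝ) : ℝ :=
  ∑ w with h w ≤ t, N.selfEnergy w (X w) +
    ∑ w with 0 < h w ∧ h w ≤ t, N.edgeEnergy s(w, par w) X +
    ∑ w with h w = t + 1, N.msgForm k (par w) w X

variable {N} {r : V} {d : ℕ} {h : V → ℕ} {par : V → V} (T : IsRootedUpTo N.graph r d h par)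

include T

open Classical in
theorem varUpdate_form {w : V} (h0 : 0 < h w) (hw : h w + 1 ≤ d) (k : ℕ)
    (X : (i : V) → Fin (N.n i) → ℝ) :
    X w ⬝ᵥ (N.varUpdate (N.msg k) w (par w) *ᵥ X w) = N.selfEnergy w (X w) +
      ∑ u ∈ (Finset.univ.filter fun u => h u = h w + 1) with par u = w,
        N.msgForm k (par u) u X := by
  classical
  rw [N.varUpdate_eq _ (T.adj_par' h0 (by omega)), Matrix.add_mulVec, dotProduct_add, form_sum]
  refine congrArg₂ _ rfl ?_
  rw [Finset.filter_filter]
  refine Finset.sum_congr (Finset.filter_congr fun u _ => T.adj_ne_par_iff h0 hw) fun u hu => ?_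
  obtain ⟨-, rfl⟩ := (Finset.mem_filter.1 hu).2
  rfl

theorem stage_zero (hd : 1 ≤ d) (k : ℕ) (X : (i : V) → Fin (N.n i) → ℝ) :
    N.stage h par 0 k X = X r ⬝ᵥ (N.nodeUpdate (N.msg k) r *ᵥ X r) := by
  classical
  rw [stage, nodeUpdate, Matrix.add_mulVec, dotProduct_add, form_sum]
  have h1 : (Finset.univ.filter fun w => h w ≤ 0) = {r} := by
    ext w; simp [T.level_eq_zero]
  have h2 : (Finset.univ.filter fun w => 0 < h w ∧ h w ≤ 0) = ∅ := by
    ext w; simp; omega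
  rw [h1, h2, Finset.sum_singleton, Finset.sum_empty, add_zero]
  refine congrArg₂ _ rfl ?_
  have h3 : (Finset.univ.filter fun w => h w = 0 + 1) =
      Finset.univ.filter fun w => N.graph.Adj r w := by
    ext w
    simp only [Finset.mem_filter, Finset.mem_univ, true_and, T.adj_root_iff hd]
    refine ⟨fun hw => ⟨hw, ?_⟩, fun hw => hw.1⟩
    have := T.level_par (w := w) (by omega) (by omega)
    exact (T.level_eq_zero _).1 (by omega)
  rw [h3]
  refine Finset.sum_congr rfl fun u hu => ?_
  obtain ⟨-, rfl⟩ := (T.adj_root_iff hd).1 (Finset.mem_filter.1 hu).2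
  rfl

theorem stage_succ {t : ℕ} (ht : t + 2 ≤ d) (k : ℕ) (X : (i : V) → Fin (N.n i) → ℝ) :
    N.stage h par (t + 1) k X - N.stage h par t (k + 1) X =
      ∑ w with h w = t + 1, (N.edgeEnergy s(w, par w) X +
        X w ⬝ᵥ (N.varUpdate (N.msg k) w (par w) *ᵥ X w) - N.msgForm (k + 1) (par w) w X) := by
  classical
  have h1 : (Finset.univ.filter fun w => h w ≤ t + 1) =
      (Finset.univ.filter fun w => h w ≤ t) ∪ (Finset.univ.filter fun w => h w = t + 1) := by
    ext w; simp; omega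
  have h2 : (Finset.univ.filter fun w => 0 < h w ∧ h w ≤ t + 1) =
      (Finset.univ.filter fun w => 0 < h w ∧ h w ≤ t) ∪
        (Finset.univ.filter fun w => h w = t + 1) := by
    ext w; simp; omega
  have d1 : Disjoint (Finset.univ.filter fun w => h w ≤ t)
      (Finset.univ.filter fun w => h w = t + 1) := by
    rw [Finset.disjoint_filter]; intros; omega
  have d2 : Disjoint (Finset.univ.filter fun w => 0 < h w ∧ h w ≤ t)
      (Finset.univ.filter fun w => h w = t + 1) := by
    rw [Finset.disjoint_filter]; intros; omega
  have h3 : ∑ w with h w = t + 1, X w ⬝ᵥ (N.varUpdate (N.msg k) w (par w) *ᵥ X w) =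
      ∑ w with h w = t + 1, N.selfEnergy w (X w) +
        ∑ w with h w = t + 1 + 1, N.msgForm k (par w) w X := by
    rw [← Finset.sum_fiberwise_of_maps_to (s := Finset.univ.filter fun w => h w = t + 1 + 1)
      (t := Finset.univ.filter fun w => h w = t + 1) (g := par), ← Finset.sum_add_distrib]
    · refine Finset.sum_congr rfl fun w hw => ?_
      have hw' := (Finset.mem_filter.1 hw).2
      rw [varUpdate_form T (by omega) (by omega), hw']
    · intro w hw
      have hw' := (Finset.mem_filter.1 hw).2
      have := T.level_par (w := w) (by omega) (by omega)
      exact Finset.mem_filter.2 ⟨Finset.mem_univ _, by omega⟩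
  rw [stage, stage, h1, h2, Finset.sum_union d1, Finset.sum_union d2, Finset.sum_sub_distrib,
    Finset.sum_add_distrib, h3]
  ring

theorem nodeUpdate_form_le_stage (hΩ : N.OmegaPos) (X : (i : V) → Fin (N.n i) → ℝ) (t k : ℕ)
    (htk : t + k + 1 = d) :
    X r ⬝ᵥ (N.nodeUpdate (N.msg (d - 1)) r *ᵥ X r) ≤ N.stage h par t k X := by
  induction t generalizing k with
  | zero =>
    obtain rfl : k = d - 1 := by omega
    rw [stage_zero T (by omega)]
  | succ t ih =>
    refine (ih (k + 1) (by omega)).trans ?_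
    rw [← sub_nonneg, stage_succ T (by omega)]
    refine Finset.sum_nonneg fun w hw => sub_nonneg.2 ?_
    have hw' := (Finset.mem_filter.1 hw).2
    exact N.msgForm_succ_le hΩ k (T.adj_par' (by omega) (by omega)).symm X

theorem nodeUpdate_form_eq_stage (hΩ : N.OmegaPos) (X : (i : V) → Fin (N.n i) → ℝ) (t k : ℕ)
    (htk : t + k + 1 = d)
    (hX : ∀ w, 0 < h w → h w ≤ t → X w = N.response (d - 1 - h w) (par w) w (X (par w))) :
    X r ⬝ᵥ (N.nodeUpdate (N.msg (d - 1)) r *ᵥ X r) = N.stage h par t k X := by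
  induction t generalizing k with
  | zero =>
    obtain rfl : k = d - 1 := by omega
    rw [stage_zero T (by omega)]
  | succ t ih =>
    refine (ih (k + 1) (by omega) fun w h0 h1 => hX w h0 (by omega)).trans ?_
    symm
    rw [← sub_eq_zero, stage_succ T (by omega)]
    refine Finset.sum_eq_zero fun w hw => sub_eq_zero.2 ?_
    have hw' := (Finset.mem_filter.1 hw).2
    have h2 := hX w (by omega) (by omega)
    rw [show d - 1 - h w = k by omega] at h2
    exact (N.msgForm_succ_eq hΩ k (T.adj_par' (by omega) (by omega)).symm h2).symm

/-- The configuration that responds optimally up to level `t` and vanishes beyond. -/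
theorem exists_responding (v : Fin (N.n r) → ℝ) (t : ℕ) (ht : t ≤ d) :
    ∃ X : (i : V) → Fin (N.n i) → ℝ, X r = v ∧
      (∀ w, 0 < h w → h w ≤ t → X w = N.response (d - 1 - h w) (par w) w (X (par w))) ∧
      ∀ w, t < h w → X w = 0 := by
  classical
  induction t with
  | zero =>
    refine ⟨Function.update 0 r v, by simp, fun w h0 h1 => by omega, fun w hw => ?_⟩
    have : w ≠ r := by
      rintro rfl
      rw [T.level_root] at hw; omega
    simp [this]
  | succ t ih =>
    obtain ⟨X, hr, hX, h0⟩ := ih (by omega)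
    refine ⟨fun w => if h w = t + 1 then N.response (d - 1 - h w) (par w) w (X (par w)) else X w,
      ?_, fun w hw hw' => ?_, fun w hw => ?_⟩
    · simp [T.level_root, hr]
    · have := T.level_par hw (by omega)
      have hp : ¬ h (par w) = t + 1 := by omega
      simp only [hp, if_false]
      split_ifs with hc
      · rfl
      · exact hX w hw (by omega)
    · have : ¬ h w = t + 1 := by omega
      simp only [this, if_false]
      exact h0 w (by omega)

theorem sum_parentEdge {m : ℕ} (hm : m ≤ d) (X : (i : V) → Fin (N.n i) → ℝ) :
    open Classical in
    ∑ w with 0 < h w ∧ h w ≤ m, N.edgeEnergy s(w, par w) X =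
      ∑ e ∈ (Finset.univ.filter fun w => 0 < h w ∧ h w ≤ m).image (fun w => s(w, par w)),
        N.edgeEnergy e X := by
  classical
  rw [Finset.sum_image]
  refine T.parentEdge_injOn.mono ?_
  intro w hw
  have := (Finset.mem_filter.1 (Finset.mem_coe.1 hw)).2
  exact ⟨this.1, by omega⟩

theorem parentEdge_subset {m : ℕ} (hm : m ≤ d) :
    open Classical in
    (Finset.univ.filter fun w => 0 < h w ∧ h w ≤ m).image (fun w => s(w, par w)) ⊆
      Finset.univ.filter fun e => e ∈ N.graph.edgeSet := by
  classical
  intro e he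
  obtain ⟨w, hw, rfl⟩ := Finset.mem_image.1 he
  have hw' := (Finset.mem_filter.1 hw).2
  exact Finset.mem_filter.2 ⟨Finset.mem_univ _, T.adj_par' hw'.1 (hw'.2.trans hm)⟩

/-- If there is no node of level `d`, the information matrix after `d` iterations bounds the energy
of all configurations from below. -/
theorem nodeInfo_form_le_energy (hΩ : N.OmegaPos) (hd : 1 ≤ d) (hno : ∀ w, h w ≠ d)
    (X : (i : V) → Fin (N.n i) → ℝ) :
    X r ⬝ᵥ (N.nodeInfo r d *ᵥ X r) ≤ N.energy X := by
  classical
  refine (nodeUpdate_form_le_stage T hΩ X (d - 1) 0 (by omega)).trans ?_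
  have h1 : (Finset.univ.filter fun w => h w = d - 1 + 1) = ∅ := by
    ext w
    have := hno w
    simp; omega
  rw [stage, h1, Finset.sum_empty, add_zero, sum_parentEdge T (by omega)]
  refine add_le_add ?_ ?_
  · exact Finset.sum_le_sum_of_subset_of_nonneg (Finset.subset_univ _)
      fun i _ _ => N.selfEnergy_nonneg i _
  · exact Finset.sum_le_sum_of_subset_of_nonneg (parentEdge_subset T (by omega))
      fun e he _ => N.edgeEnergy_nonneg (Finset.mem_filter.1 he).2 _

/-- The information matrix after `d` iterations is the energy of some configuration: the optimal one
among those that vanish on all nodes of level at least `d`. -/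
theorem exists_energy_eq_nodeInfo_form (hΩ : N.OmegaPos) (hd : 1 ≤ d) (v : Fin (N.n r) → ℝ) :
    ∃ X : (i : V) → Fin (N.n i) → ℝ, X r = v ∧ N.energy X = v ⬝ᵥ (N.nodeInfo r d *ᵥ v) := by
  classical
  obtain ⟨X, rfl, hX, h0⟩ := exists_responding T v (d - 1) (by omega)
  refine ⟨X, rfl, ?_⟩
  have h1 := nodeUpdate_form_eq_stage T hΩ X (d - 1) 0 (by omega) hX
  rw [nodeInfo, h1, stage]
  have h2 : ∑ w with h w = d - 1 + 1, N.msgForm 0 (par w) w X =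
      ∑ w with h w = d, N.edgeEnergy s(w, par w) X := by
    rw [show d - 1 + 1 = d by omega]
    refine Finset.sum_congr rfl fun w hw => ?_
    have hw' := (Finset.mem_filter.1 hw).2
    exact N.msgForm_zero (T.adj_par' (by omega) (by omega)).symm (h0 w (by omega))
  have h3 : ∑ w with 0 < h w ∧ h w ≤ d - 1, N.edgeEnergy s(w, par w) X +
      ∑ w with h w = d, N.edgeEnergy s(w, par w) X =
      ∑ w with 0 < h w ∧ h w ≤ d, N.edgeEnergy s(w, par w) X := by
    rw [← Finset.sum_union]
    · refine Finset.sum_congr ?_ fun _ _ => rfl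
      ext w; simp; omega
    · rw [Finset.disjoint_filter]; intros; omega
  rw [h2, add_assoc, h3, sum_parentEdge T le_rfl, energy]
  refine congrArg₂ _ ?_ ?_
  · refine (Finset.sum_subset (Finset.subset_univ _) fun w _ hw => ?_).symm
    have : ¬ h w ≤ d - 1 := fun hc => hw (Finset.mem_filter.2 ⟨Finset.mem_univ _, hc⟩)
    rw [h0 w (by omega)]
    simp [selfEnergy]
  · refine (Finset.sum_subset (parentEdge_subset T le_rfl) fun e he hne => ?_).symm
    have he' := (Finset.mem_filter.1 he).2
    -- an edge that is not of the form `s(w, par w)` has both ends on levels at least `d`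
    have key : ∀ a b, N.graph.Adj a b → s(a, b) = e → X a = 0 := by
      intro a b hab hs
      refine h0 a ?_
      by_contra hc
      refine hne (Finset.mem_image.2 ?_)
      rcases T.of_adj a b (by omega) hab with h4 | h4
      · obtain ⟨-, h5⟩ := (T.adj_deeper_iff (by omega)).1 ⟨hab, h4⟩
        exact ⟨b, Finset.mem_filter.2 ⟨Finset.mem_univ _, by omega, by omega⟩,
          by rw [h5, Sym2.eq_swap, hs]⟩
      · exact ⟨a, Finset.mem_filter.2 ⟨Finset.mem_univ _, by omega, by omega⟩,
          by rw [← h4.2, hs]⟩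
    induction e with
    | h a b =>
      have hab : N.graph.Adj a b := he'
      rw [edgeEnergy, N.edgeValue_mk hab.ne, key a b hab rfl, key b a hab.symm Sym2.eq_swap]
      simp

end MeasurementSystem

/-! ### Acyclic balls -/

section Balls

variable {V : Type*} {G : SimpleGraph V} {r : V} {d : ℕ}

theorem mem_hopBall {v : V} : v ∈ hopBall G r d ↔ G.edist r v ≤ d := Iff.rfl

theorem edist_le_add_one {w u : V} (h : G.Adj w u) : G.edist r u ≤ G.edist r w + 1 :=
  G.edist_triangle.trans (by rw [SimpleGraph.edist_eq_one_iff_adj.2 h])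

theorem exists_isPath_length_le {u : V} (h : G.edist r u ≠ ⊤) :
    ∃ p : G.Walk r u, p.IsPath ∧ (p.length : ℕ∞) ≤ G.edist r u := by
  classical
  obtain ⟨p, hp⟩ := SimpleGraph.exists_walk_of_edist_ne_top h
  exact ⟨p.bypass, p.bypass_isPath, by rw [← hp]; exact_mod_cast p.length_bypass_le_length⟩

theorem edist_le_of_mem_support {u x : V} (p : G.Walk r u) (hx : x ∈ p.support) :
    G.edist r x ≤ p.length := by
  classical
  exact (p.takeUntil x hx).edist_le.trans (by exact_mod_cast p.length_takeUntil_le_length hx)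

theorem notMem_support_of_edist_le {u w : V} (p : G.Walk r u)
    (hp : (p.length : ℕ∞) ≤ G.edist r u) (hne : w ≠ u) (h : G.edist r u ≤ G.edist r w) :
    w ∉ p.support := by
  classical
  intro hw
  have h1 := (p.takeUntil w hw).edist_le
  have h2 := congrArg SimpleGraph.Walk.length (p.take_spec hw)
  rw [SimpleGraph.Walk.length_append] at h2
  have h3 : p.length ≤ (p.takeUntil w hw).length := by
    exact_mod_cast (hp.trans h).trans h1
  exact hne (SimpleGraph.Walk.eq_of_length_eq_zero (p := p.dropUntil w hw) (by omega))

/-- In an acyclic ball, a node has at most one neighbour that is not farther from the centre. -/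
theorem eq_of_adj_of_edist_le (hac : (G.induce (hopBall G r d)).IsAcyclic) {w u u' : V}
    (hw : w ∈ hopBall G r d) (h : G.Adj w u) (h' : G.Adj w u') (hu : G.edist r u ≤ G.edist r w)
    (hu' : G.edist r u' ≤ G.edist r w) : u = u' := by
  have hwtop : G.edist r w ≠ ⊤ := ne_top_of_le_ne_top (ENat.natCast_ne_top d) hw
  have key : ∀ {x : V} (hx : G.Adj w x), G.edist r x ≤ G.edist r w →
      ∃ p : G.Walk r x, (p.concat hx.symm).IsPath ∧
        ∀ z ∈ (p.concat hx.symm).support, z ∈ hopBall G r d := by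
    intro x hx hxw
    obtain ⟨p, hp, hpl⟩ := exists_isPath_length_le (ne_top_of_le_ne_top hwtop hxw)
    refine ⟨p, hp.concat (notMem_support_of_edist_le p hpl hx.ne hxw) _, fun z hz => ?_⟩
    rw [SimpleGraph.Walk.support_concat, List.mem_append, List.mem_singleton] at hz
    rcases hz with hz | rfl
    · exact (edist_le_of_mem_support p hz).trans ((hpl.trans hxw).trans hw)
    · exact hw
  obtain ⟨p, hp, hps⟩ := key h hu
  obtain ⟨p', hp', hps'⟩ := key h' hu'
  have hI : ∀ {q : G.Walk r w} (hq : q.IsPath) (hs : ∀ z ∈ q.support, z ∈ hopBall G r d),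
      (q.induce _ hs).IsPath := by
    intro q hq hs
    refine SimpleGraph.Walk.IsPath.of_map (f := (SimpleGraph.Embedding.induce _).toHom) ?_
    rw [SimpleGraph.Walk.map_induce]
    exact hq
  have he := (hac.subsingleton_path _ _).elim ⟨_, hI hp hps⟩ ⟨_, hI hp' hps'⟩
  have he' : (p.concat h.symm).support = (p'.concat h'.symm).support := by
    have := congrArg (fun q => (SimpleGraph.Walk.map (SimpleGraph.Embedding.induce _).toHom
      q.1).support) he
    simp only [SimpleGraph.Walk.map_induce] at this
    exact this
  rw [SimpleGraph.Walk.support_concat, SimpleGraph.Walk.support_concat] at he'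
  have h3 := List.append_cancel_right he'
  have h4 := congrArg List.getLast? h3
  rwa [List.getLast?_eq_getLast_of_ne_nil p.support_ne_nil,
    List.getLast?_eq_getLast_of_ne_nil p'.support_ne_nil, SimpleGraph.Walk.getLast_support,
    SimpleGraph.Walk.getLast_support, Option.some_inj] at h4

/-- The distance from `r`, cut off at `d + 1`. -/
noncomputable def level (G : SimpleGraph V) (r : V) (d : ℕ) (w : V) : ℕ :=
  (min (G.edist r w) ((d + 1 : ℕ) : ℕ∞)).toNat

theorem coe_level (w : V) : (level G r d w : ℕ∞) = min (G.edist r w) ((d + 1 : ℕ) : ℕ∞) :=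
  ENat.natCast_toNat (ne_top_of_le_ne_top (ENat.natCast_ne_top _) (min_le_right _ _))

theorem level_le (w : V) : level G r d w ≤ d + 1 := by
  have : (level G r d w : ℕ∞) ≤ ((d + 1 : ℕ) : ℕ∞) := by
    rw [coe_level]; exact min_le_right _ _
  exact_mod_cast this

theorem level_le_iff {w : V} : level G r d w ≤ d ↔ w ∈ hopBall G r d := by
  rw [mem_hopBall, ← ENat.natCast_le_natCast, coe_level, min_le_iff, or_iff_left]
  rw [ENat.natCast_le_natCast]; omega

theorem coe_level_of_le {w : V} (h : level G r d w ≤ d) : (level G r d w : ℕ∞) = G.edist r w := by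
  rw [coe_level, min_eq_left]
  exact (mem_hopBall.1 (level_le_iff.1 h)).trans (by exact_mod_cast Nat.le_succ d)

theorem level_eq_of_edist {w : V} {k : ℕ} (h : G.edist r w = k) (hk : k ≤ d + 1) :
    level G r d w = k := by
  have : (level G r d w : ℕ∞) = k := by
    rw [coe_level, h, min_eq_left]; exact_mod_cast hk
  exact_mod_cast this

theorem exists_adj_edist_add_one {w : V} {k : ℕ} (h : G.edist r w = (k + 1 : ℕ)) :
    ∃ u, G.Adj w u ∧ G.edist r u = k := by
  obtain ⟨p, hp⟩ := SimpleGraph.exists_walk_of_edist_eq_coe h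
  have hn : ¬ p.Nil := by rw [← SimpleGraph.Walk.length_eq_zero_iff]; omega
  have ha := (p.adj_penultimate hn).symm
  refine ⟨p.penultimate, ha, le_antisymm ?_ ?_⟩
  · refine p.dropLast.edist_le.trans ?_
    rw [SimpleGraph.Walk.length_dropLast, hp]; rfl
  · have := edist_le_add_one (r := r) ha.symm
    rw [h] at this
    push_cast at this
    exact (ENat.add_le_add_iff_right ENat.one_ne_top).1 this

/-- An acyclic ball around `r` is a tree, rooted at `r` and with the distance from `r` as level. -/
theorem exists_isRootedUpTo (hac : (G.induce (hopBall G r d)).IsAcyclic) :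
    ∃ par, IsRootedUpTo G r d (level G r d) par := by
  classical
  have hex : ∀ w, ∃ u, 0 < level G r d w → level G r d w ≤ d →
      G.Adj w u ∧ G.edist r u + 1 = G.edist r w ∧ level G r d u + 1 = level G r d w := by
    intro w
    by_cases hw : 0 < level G r d w ∧ level G r d w ≤ d
    · obtain ⟨k, hk⟩ := Nat.exists_eq_succ_of_ne_zero hw.1.ne'
      have h1 := coe_level_of_le hw.2
      rw [hk] at h1
      obtain ⟨u, hu, hu'⟩ := exists_adj_edist_add_one h1.symm
      refine ⟨u, fun _ _ => ⟨hu, ?_, ?_⟩⟩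
      · rw [hu', ← h1]; rfl
      · rw [level_eq_of_edist hu' (by omega), hk]
    · exact ⟨w, fun h0 h1 => absurd ⟨h0, h1⟩ hw⟩
  choose par hpar using hex
  refine ⟨par, ⟨fun w => ?_, fun w h0 h1 => ⟨(hpar w h0 h1).1, (hpar w h0 h1).2.2⟩,
    fun w u hw hwu => ?_⟩⟩
  · constructor
    · intro h0
      have := coe_level_of_le (G := G) (r := r) (d := d) (w := w) (by omega)
      rw [h0] at this
      exact (SimpleGraph.edist_eq_zero_iff.1 this.symm).symm
    · rintro rfl
      exact level_eq_of_edist (k := 0) (by simp) (by omega)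
  · have hwd := coe_level_of_le hw
    have h1 := edist_le_add_one (r := r) hwu
    by_cases hc : G.edist r u ≤ G.edist r w
    · right
      have h0 : 0 < level G r d w := by
        rw [pos_iff_ne_zero]
        intro h0
        rw [h0] at hwd
        rw [← hwd] at hc
        have e1 := SimpleGraph.edist_eq_zero_iff.1 (le_antisymm hc zero_le)
        have e2 := SimpleGraph.edist_eq_zero_iff.1 hwd.symm
        exact hwu.ne (e2.symm.trans e1)
      obtain ⟨h2, h3, -⟩ := hpar w h0 hw
      exact ⟨h0, eq_of_adj_of_edist_le hac (level_le_iff.1 hw) hwu h2 hc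
        (by rw [← h3]; exact le_self_add)⟩
    · left
      push Not at hc
      have h2 : G.edist r u = ((level G r d w + 1 : ℕ) : ℕ∞) := by
        refine le_antisymm (by rw [← hwd] at h1; exact_mod_cast h1) ?_
        rw [← hwd] at hc
        exact_mod_cast Order.add_one_le_of_lt hc
      exact level_eq_of_edist h2 (by omega)

theorem hopBall_mono {d d' : ℕ} (h : d ≤ d') : hopBall G r d ⊆ hopBall G r d' :=
  fun _ hv => le_trans (mem_hopBall.1 hv) (by exact_mod_cast h)

theorem isAcyclic_ball_of_le {d d' : ℕ} (h : d ≤ d')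
    (hac : (G.induce (hopBall G r d')).IsAcyclic) : (G.induce (hopBall G r d)).IsAcyclic :=
  hac.embedding (G.induceHomOfLE (hopBall_mono h))

theorem isAcyclic_ball_of_le_cycleFreeDepth (hd : 1 ≤ d) (h : (d : ℕ∞) ≤ cycleFreeDepth G r) :
    (G.induce (hopBall G r d)).IsAcyclic := by
  have h1 : ((d - 1 : ℕ) : ℕ∞) < cycleFreeDepth G r :=
    lt_of_lt_of_le (by exact_mod_cast (by omega : d - 1 < d)) h
  rw [cycleFreeDepth, lt_iSup_iff] at h1
  obtain ⟨d', h1⟩ := h1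
  rw [lt_iSup_iff] at h1
  obtain ⟨h2, h3⟩ := h1
  have h4 : d - 1 < d' := by exact_mod_cast h3
  exact isAcyclic_ball_of_le (by omega) h2

theorem level_ne_of_card_lt [Fintype V] (hd : Fintype.card V ≤ d) (w : V) : level G r d w ≠ d := by
  intro h
  have h1 := coe_level_of_le h.le
  obtain ⟨p, hp, hpl⟩ := exists_isPath_length_le (G := G) (r := r) (u := w)
    (by rw [← h1]; exact ENat.natCast_ne_top _)
  have h2 : G.edist r w ≤ p.length := p.edist_le
  rw [← h1, h] at h2
  have h3 : d ≤ p.length := by exact_mod_cast h2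
  have := hp.length_lt
  omega

end Balls

/-! ### The reduced graph -/

section ReducedGraph

variable {V : Type*} {G : SimpleGraph V} {i : V} {d : ℕ}

theorem self_mem_hopBall : i ∈ hopBall G i d := by
  rw [mem_hopBall, SimpleGraph.edist_self]; exact zero_le

/-- The central node of the ball, as a node of the reduced graph. -/
def reducedRoot (G : SimpleGraph V) (i : V) (d : ℕ) : ReducedNode G i d :=
  .inl ⟨i, self_mem_hopBall⟩

/-- The level of a node of the reduced graph: the distance from the root. -/
noncomputable def reducedLevel (G : SimpleGraph V) (i : V) (d : ℕ) : ReducedNode G i d → ℕ :=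
  Sum.elim (fun a => level G i d a.1) (fun _ => d + 1)

open Classical in
/-- The parent of a node of the reduced graph: the parent in the ball, or the node to which the copy
of a child node is attached. -/
noncomputable def reducedPar (G : SimpleGraph V) (i : V) (d : ℕ) (par : V → V) :
    ReducedNode G i d → ReducedNode G i d :=
  Sum.elim (fun a => if ha : par a.1 ∈ hopBall G i d then .inl ⟨par a.1, ha⟩ else .inl a)
    (fun p => .inl ⟨p.1.2, p.2.2.1⟩)

theorem level_eq_of_mem_childCopies {p : V × V} (hp : p ∈ childCopies G i d) :
    level G i d p.2 = d := by
  have h1 := level_le_iff.2 hp.2.1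
  refine le_antisymm h1 ?_
  by_contra hc
  refine hp.1 ?_
  have h2 := edist_le_add_one (r := i) hp.2.2.symm
  rw [← coe_level_of_le h1] at h2
  rw [mem_hopBall]
  exact h2.trans (by exact_mod_cast (by omega : level G i d p.2 + 1 ≤ d))

theorem reducedLevel_le (a : ReducedNode G i d) : reducedLevel G i d a ≤ d + 1 := by
  rcases a with a | p
  · exact level_le _
  · exact le_rfl

/-- If the ball is a tree, so is the reduced graph, to every depth. -/
theorem isRootedUpTo_reducedGraph {par : V → V} (T : IsRootedUpTo G i d (level G i d) par) (D : ℕ) :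
    IsRootedUpTo (reducedGraph G i d) (reducedRoot G i d) D (reducedLevel G i d)
      (reducedPar G i d par) := by
  have hpar : ∀ a : hopBall G i d, 0 < level G i d a.1 → ∃ ha : par a.1 ∈ hopBall G i d,
      reducedPar G i d par (.inl a) = .inl ⟨par a.1, ha⟩ := by
    intro a ha
    have ha' := level_le_iff.2 a.2
    have h1 : par a.1 ∈ hopBall G i d := by
      rw [← level_le_iff]
      have := T.level_par ha ha'
      omega
    exact ⟨h1, by simp [reducedPar, h1]⟩
  refine ⟨?_, ?_, ?_⟩
  · rintro (a | p)
    · change level G i d a.1 = 0 ↔ Sum.inl a = Sum.inl _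
      rw [T.level_eq_zero, Sum.inl.injEq, Subtype.ext_iff]
    · simp [reducedLevel, reducedRoot]
  · rintro (a | p) h0 -
    · obtain ⟨h1, h2⟩ := hpar a h0
      rw [h2]
      exact T.adj_par a.1 h0 (level_le_iff.2 a.2)
    · exact ⟨rfl, congrArg (· + 1) (level_eq_of_mem_childCopies p.2)⟩
  · rintro (a | p) (b | q) - hab
    · rcases T.of_adj a.1 b.1 (level_le_iff.2 a.2) hab with h1 | ⟨h1, h2⟩
      · exact .inl h1
      · refine .inr ⟨h1, ?_⟩
        obtain ⟨h3, h4⟩ := hpar a h1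
        rw [h4, Sum.inl.injEq, Subtype.ext_iff]
        exact h2
    · refine .inl ?_
      have h1 : q.1.2 = a.1 := hab
      have h2 := level_eq_of_mem_childCopies q.2
      rw [h1] at h2
      exact congrArg (· + 1) h2.symm
    · have h1 : p.1.2 = b.1 := hab
      exact .inr ⟨Nat.succ_pos _, congrArg Sum.inl (Subtype.ext h1.symm)⟩
    · exact hab.elim

/-- The neighbours of a node of the ball in the reduced graph are those in the original graph. -/
theorem sum_adj_reducedGraph [Fintype V] {M : Type*} [AddCommMonoid M] (a : hopBall G i d)
    (F : V → M) (F' : ReducedNode G i d → M)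
    (hF : ∀ b, (reducedGraph G i d).Adj (.inl a) b → F' b = F (reducedProj G i d b)) :
    open Classical in
    ∑ b with (reducedGraph G i d).Adj (.inl a) b, F' b = ∑ w with G.Adj a.1 w, F w := by
  classical
  refine Finset.sum_bij (fun b _ => reducedProj G i d b) ?_ ?_ ?_ ?_
  · intro b hb
    exact Finset.mem_filter.2 ⟨Finset.mem_univ _,
      reducedProj_adj G i d (.inl a) b (Finset.mem_filter.1 hb).2⟩
  · intro b hb b' hb' h
    have h1 := (Finset.mem_filter.1 hb).2
    have h2 := (Finset.mem_filter.1 hb').2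
    rcases b with b | p <;> rcases b' with b' | p'
    · exact congrArg Sum.inl (Subtype.ext h)
    · have h3 : b.1 = p'.1.1 := h
      exact absurd (h3 ▸ b.2) p'.2.1
    · have h3 : p.1.1 = b'.1 := h
      exact absurd (h3.symm ▸ b'.2) p.2.1
    · have h3 : p.1.2 = a.1 := h1
      have h4 : p'.1.2 = a.1 := h2
      exact congrArg Sum.inr (Subtype.ext (Prod.ext h (h3.trans h4.symm)))
  · intro w hw
    have hw' := (Finset.mem_filter.1 hw).2
    by_cases hb : w ∈ hopBall G i d
    · exact ⟨.inl ⟨w, hb⟩, Finset.mem_filter.2 ⟨Finset.mem_univ _, hw'⟩, rfl⟩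
    · exact ⟨.inr ⟨(w, a.1), hb, a.2, hw'.symm⟩,
        Finset.mem_filter.2 ⟨Finset.mem_univ _, rfl⟩, rfl⟩
  · intro b hb
    exact hF b (Finset.mem_filter.1 hb).2

theorem reducedProj_edge_injOn :
    Set.InjOn (Sym2.map (reducedProj G i d)) (reducedGraph G i d).edgeSet := by
  have key : ∀ a b a' b' : ReducedNode G i d, (reducedGraph G i d).Adj a b →
      (reducedGraph G i d).Adj a' b' → reducedProj G i d a = reducedProj G i d a' →
      reducedProj G i d b = reducedProj G i d b' → a = a' := by
    rintro (a | p) (b | q) (a' | p') (b' | q') h h' ha hb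
    all_goals first
      | exact congrArg Sum.inl (Subtype.ext ha)
      | exact h.elim
      | exact h'.elim
      | exact absurd (show p'.1.1 ∈ hopBall G i d from (show a.1 = p'.1.1 from ha) ▸ a.2) p'.2.1
      | exact absurd (show p.1.1 ∈ hopBall G i d from (show a'.1 = p.1.1 from ha.symm) ▸ a'.2) p.2.1
      | skip
    have h1 : p.1.2 = b.1 := h
    have h2 : p'.1.2 = b'.1 := h'
    have h3 : b.1 = b'.1 := hb
    exact congrArg Sum.inr (Subtype.ext (Prod.ext ha (h1.trans (h3.trans h2.symm))))
  intro e he e' he' h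
  induction e with
  | h a b =>
    induction e' with
    | h a' b' =>
      have h1 : (reducedGraph G i d).Adj a b := he
      have h2 : (reducedGraph G i d).Adj a' b' := he'
      rcases Sym2.eq_iff.1 h with ⟨h3, h4⟩ | ⟨h3, h4⟩
      · rw [key a b a' b' h1 h2 h3 h4, key b a b' a' h1.symm h2.symm h4 h3]
      · rw [key a b b' a' h1 h2.symm h3 h4, key b a a' b' h1.symm h2 h4 h3, Sym2.eq_swap]

/-- The copies of a node share its self measurement. -/
theorem sum_inv_copyCount_le_one [Fintype V] (v : V) :
    open Classical in
    ∑ a : ReducedNode G i d with reducedProj G i d a = v, ((copyCount G i d a : ℝ))⁻¹ ≤ 1 := by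
  classical
  by_cases hv : v ∈ hopBall G i d
  · have h1 : (Finset.univ.filter fun a : ReducedNode G i d => reducedProj G i d a = v) =
        {.inl ⟨v, hv⟩} := by
      ext a
      simp only [Finset.mem_filter, Finset.mem_univ, true_and, Finset.mem_singleton]
      rcases a with a | p
      · rw [Sum.inl.injEq, Subtype.ext_iff]; rfl
      · simp only [reducedProj, Sum.elim_inr, reduceCtorEq, iff_false]
        rintro rfl
        exact p.2.1 hv
    rw [h1, Finset.sum_singleton]
    simp [copyCount]
  · set U : Set V := {u | u ∈ hopBall G i d ∧ G.Adj v u} with hU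
    set s := Finset.univ.filter fun a : ReducedNode G i d => reducedProj G i d a = v with hs
    have h1 : ∀ a ∈ s, ∃ p : childCopies G i d, a = .inr p ∧ p.1.1 = v := by
      intro a ha
      have ha' := (Finset.mem_filter.1 ha).2
      rcases a with a | p
      · exact absurd ((show a.1 = v from ha') ▸ a.2) hv
      · exact ⟨p, rfl, ha'⟩
    have h2 : ∀ a ∈ s, ((copyCount G i d a : ℝ))⁻¹ = (U.ncard : ℝ)⁻¹ := by
      intro a ha
      obtain ⟨p, rfl, rfl⟩ := h1 a ha
      rfl
    have h3 : s.card ≤ U.ncard := by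
      rw [Set.ncard_eq_toFinset_card']
      refine Finset.card_le_card_of_injOn (Sum.elim (fun _ => i) (fun p => p.1.2)) ?_ ?_
      · intro a ha
        obtain ⟨p, rfl, rfl⟩ := h1 a ha
        simpa [hU] using p.2.2
      · intro a ha b hb hab
        obtain ⟨p, rfl, hp⟩ := h1 a ha
        obtain ⟨q, rfl, hq⟩ := h1 b hb
        exact congrArg Sum.inr (Subtype.ext (Prod.ext (hp.trans hq.symm) hab))
    rw [Finset.sum_congr rfl h2, Finset.sum_const, nsmul_eq_mul, ← div_eq_mul_inv]
    exact div_le_one_of_le₀ (by exact_mod_cast h3) (Nat.cast_nonneg _)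

end ReducedGraph

theorem transpose_mul_inv_smul_mul {ι κ : Type*} [Fintype ι] [DecidableEq ι]
    {R : Matrix ι ι ℝ} (hR : R.PosDef) {c : ℝ} (hc : c ≠ 0) (C : Matrix ι κ ℝ) :
    Cᵀ * (c • R)⁻¹ * C = c⁻¹ • (Cᵀ * R⁻¹ * C) := by
  have h : (c • R)⁻¹ = c⁻¹ • R⁻¹ := by
    refine Matrix.inv_eq_left_inv ?_
    rw [Matrix.smul_mul, Matrix.mul_smul, smul_smul, inv_mul_cancel₀ hc, one_smul,
      posDef_inv_mul hR]
  rw [h, Matrix.mul_smul, Matrix.smul_mul]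

theorem form_smul {ι : Type*} [Fintype ι] (c : ℝ) (A : Matrix ι ι ℝ) (x : ι → ℝ) :
    x ⬝ᵥ ((c • A) *ᵥ x) = c * (x ⬝ᵥ (A *ᵥ x)) := by
  rw [Matrix.smul_mulVec, dotProduct_smul, smul_eq_mul]

namespace MeasurementSystem

variable {V : Type*} [Fintype V] (N : MeasurementSystem V) (i : V) (d : ℕ)

theorem selfInfo_reduced (a : ReducedNode N.graph i d) : (N.reduced i d).selfInfo a =
    ((copyCount N.graph i d a : ℝ))⁻¹ • N.selfInfo (reducedProj N.graph i d a) := by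
  have hc : (copyCount N.graph i d a : ℝ) ≠ 0 := by
    exact_mod_cast (copyCount_pos N.graph i d a).ne'
  exact transpose_mul_inv_smul_mul (N.selfR_pos (reducedProj N.graph i d a)) hc
    (N.selfC (reducedProj N.graph i d a))

variable {i d}

theorem nodeUpdate_reduced {M : (i j : V) → Matrix (Fin (N.n i)) (Fin (N.n i)) ℝ}
    {M' : (a b : ReducedNode N.graph i d) →
      Matrix (Fin ((N.reduced i d).n a)) (Fin ((N.reduced i d).n a)) ℝ} (a : hopBall N.graph i d)
    (h : ∀ b, (reducedGraph N.graph i d).Adj (.inl a) b →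
      M' (.inl a) b = M a.1 (reducedProj N.graph i d b)) :
    (N.reduced i d).nodeUpdate M' (.inl a) = N.nodeUpdate M a.1 := by
  have h1 : (N.reduced i d).selfInfo (.inl a) = N.selfInfo a.1 := by
    refine (N.selfInfo_reduced i d (.inl a)).trans ?_
    change ((1 : ℕ) : ℝ)⁻¹ • N.selfInfo a.1 = _
    rw [Nat.cast_one, inv_one, one_smul]
  exact congrArg₂ (· + ·) h1 (sum_adj_reducedGraph a (M a.1) (M' (.inl a)) h)

/-- Belief propagation on the reduced graph agrees with that on the original graph as long as no
message from the copies of the child nodes, other than the initial ones, arrives. -/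
theorem msg_reduced (k : ℕ) (a : hopBall N.graph i d) (ha : level N.graph i d a.1 + k ≤ d)
    (b : ReducedNode N.graph i d) (hab : (reducedGraph N.graph i d).Adj (.inl a) b) :
    (N.reduced i d).msg k (.inl a) b = N.msg k a.1 (reducedProj N.graph i d b) := by
  induction k generalizing a b with
  | zero => rfl
  | succ k ih =>
    rcases b with b | p
    · have hb : level N.graph i d b.1 + k ≤ d := by
        have h1 := edist_le_add_one (r := i) (show N.graph.Adj a.1 b.1 from hab)
        rw [← coe_level_of_le (level_le_iff.2 a.2), ← coe_level_of_le (level_le_iff.2 b.2)] at h1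
        have h2 : level N.graph i d b.1 ≤ level N.graph i d a.1 + 1 := by exact_mod_cast h1
        omega
      have h1 : (N.reduced i d).varUpdate ((N.reduced i d).msg k) (.inl b) (.inl a) =
          N.varUpdate (N.msg k) b.1 a.1 :=
        congrArg₂ (· - ·) (N.nodeUpdate_reduced b fun c hc => ih b hb c hc)
          (ih b hb (.inl a) hab.symm)
      exact congrArg (fun P : Matrix (Fin (N.n b.1)) (Fin (N.n b.1)) ℝ =>
        (N.jointC s(b.1, a.1) a.1)ᵀ * (N.jointR s(b.1, a.1) +
          N.jointC s(b.1, a.1) b.1 * P⁻¹ * (N.jointC s(b.1, a.1) b.1)ᵀ)⁻¹ *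
            N.jointC s(b.1, a.1) a.1) h1
    · have h1 : p.1.2 = a.1 := hab
      have h2 := level_eq_of_mem_childCopies p.2
      rw [h1] at h2
      omega

theorem nodeInfo_reduced (hd : 1 ≤ d) :
    (N.reduced i d).nodeInfo (reducedRoot N.graph i d) d = N.nodeInfo i d := by
  have h0 : level N.graph i d i = 0 := level_eq_of_edist (k := 0) (by simp) (by omega)
  exact N.nodeUpdate_reduced ⟨i, self_mem_hopBall⟩ fun b hb =>
    N.msg_reduced (d - 1) _ (by change level N.graph i d i + _ ≤ _; omega) b hb

/-- Copying a configuration to the reduced graph does not increase the energy. -/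
theorem energy_reduced_le (X : (i : V) → Fin (N.n i) → ℝ) :
    (N.reduced i d).energy (fun a => X (reducedProj N.graph i d a)) ≤ N.energy X := by
  classical
  refine add_le_add ?_ ?_
  · have h1 : ∀ a, (N.reduced i d).selfEnergy a (X (reducedProj N.graph i d a)) =
        ((copyCount N.graph i d a : ℝ))⁻¹ * N.selfEnergy (reducedProj N.graph i d a)
          (X (reducedProj N.graph i d a)) := by
      intro a
      have h2 := congrArg (fun A : Matrix (Fin (N.n (reducedProj N.graph i d a))) _ ℝ =>
        X (reducedProj N.graph i d a) ⬝ᵥ (A *ᵥ X (reducedProj N.graph i d a)))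
        (N.selfInfo_reduced i d a)
      exact h2.trans (form_smul _ _ _)
    rw [Finset.sum_congr rfl fun a _ => h1 a, ← Finset.sum_fiberwise_of_maps_to
      (t := Finset.univ) (g := reducedProj N.graph i d) fun _ _ => Finset.mem_univ _]
    refine Finset.sum_le_sum fun v _ => ?_
    have h2 : ∑ a with reducedProj N.graph i d a = v, ((copyCount N.graph i d a : ℝ))⁻¹ *
        N.selfEnergy (reducedProj N.graph i d a) (X (reducedProj N.graph i d a)) =
        (∑ a with reducedProj N.graph i d a = v, ((copyCount N.graph i d a : ℝ))⁻¹) *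
          N.selfEnergy v (X v) := by
      rw [Finset.sum_mul]
      refine Finset.sum_congr rfl fun a ha => ?_
      obtain rfl := (Finset.mem_filter.1 ha).2
      rfl
    rw [h2]
    exact mul_le_of_le_one_left (N.selfEnergy_nonneg _ _) (sum_inv_copyCount_le_one v)
  · have h1 : ∀ e ∈ Finset.univ.filter (fun e => e ∈ (N.reduced i d).graph.edgeSet),
        (N.reduced i d).edgeEnergy e (fun a => X (reducedProj N.graph i d a)) =
          N.edgeEnergy (e.map (reducedProj N.graph i d)) X := by
      intro e he
      have he' := (Finset.mem_filter.1 he).2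
      have h2 : (N.reduced i d).edgeValue e (fun a => X (reducedProj N.graph i d a)) =
          N.edgeValue (e.map (reducedProj N.graph i d)) X := by
        induction e with
        | h a b =>
          have hab : (reducedGraph N.graph i d).Adj a b := he'
          refine ((N.reduced i d).edgeValue_mk hab.ne _).trans ?_
          exact (N.edgeValue_mk (reducedProj_adj _ _ _ _ _ hab).ne X).symm
      change _ ⬝ᵥ ((N.jointR (e.map (reducedProj N.graph i d)))⁻¹ *ᵥ _) = _ ⬝ᵥ _
      rw [h2]
    rw [Finset.sum_congr rfl h1, ← Finset.sum_image (f := fun e => N.edgeEnergy e X)]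
    · refine Finset.sum_le_sum_of_subset_of_nonneg ?_
        fun e he _ => N.edgeEnergy_nonneg (Finset.mem_filter.1 he).2 _
      intro e he
      obtain ⟨e', he', rfl⟩ := Finset.mem_image.1 he
      exact Finset.mem_filter.2 ⟨Finset.mem_univ _,
        reducedProj_edge _ _ _ _ (Finset.mem_filter.1 he').2⟩
    · refine reducedProj_edge_injOn.mono fun e he => ?_
      exact (Finset.mem_filter.1 (Finset.mem_coe.1 he)).2

end MeasurementSystem

/-! ### Convergence of the messages on a tree, and its rate -/

namespace MeasurementSystem

variable {V : Type*} [Fintype V] {N : MeasurementSystem V}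

theorem varUpdate_congr {M M' : (i j : V) → Matrix (Fin (N.n i)) (Fin (N.n i)) ℝ} {i j : V}
    (hij : N.graph.Adj i j) (h : ∀ w, N.graph.Adj i w → w ≠ j → M i w = M' i w) :
    N.varUpdate M i j = N.varUpdate M' i j := by
  classical
  rw [N.varUpdate_eq _ hij, N.varUpdate_eq _ hij]
  refine congrArg₂ _ rfl (Finset.sum_congr rfl fun w hw => ?_)
  have hw' := (Finset.mem_filter.1 hw).2
  exact h w hw'.1 hw'.2

theorem msg_succ_congr {k k' : ℕ} {i j : V}
    (h : N.varUpdate (N.msg k) j i = N.varUpdate (N.msg k') j i) :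
    N.msg (k + 1) i j = N.msg (k' + 1) i j := by
  simp only [msg, covUpdate, h]

/-- The message from `j` to `i` becomes stationary if those to `j` from its other neighbours do. -/
theorem eventually_stationary_of_forall {i j : V} (hij : N.graph.Adj i j)
    (h : ∀ w, N.graph.Adj j w → w ≠ i → ∀ᶠ k in atTop, N.msg (k + 1) j w = N.msg k j w) :
    ∀ᶠ k in atTop, N.msg (k + 1) i j = N.msg k i j := by
  have h1 : ∀ᶠ k in atTop, ∀ w, N.graph.Adj j w → w ≠ i → N.msg (k + 1) j w = N.msg k j w := by
    simp only [eventually_all]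
    exact h
  obtain ⟨K, hK⟩ := eventually_atTop.1 h1
  refine eventually_atTop.2 ⟨K + 1, fun k hk => ?_⟩
  obtain ⟨k, rfl⟩ : ∃ k', k = k' + 1 := ⟨k - 1, by omega⟩
  exact msg_succ_congr (varUpdate_congr hij.symm (hK k (by omega)))

section Stationary

variable {r : V} {D : ℕ} {h : V → ℕ} {par : V → V} (T : IsRootedUpTo N.graph r D h par)
  (hD : ∀ w, h w < D)

include T hD

theorem eventually_stationary_up (n : ℕ) (w : V) (h0 : 0 < h w) (hn : D ≤ h w + n) :
    ∀ᶠ k in atTop, N.msg (k + 1) (par w) w = N.msg k (par w) w := by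
  induction n generalizing w with
  | zero => exact absurd hn (by have := hD w; omega)
  | succ n ih =>
    refine eventually_stationary_of_forall (T.adj_par' h0 (hD w).le).symm fun u hu hne => ?_
    obtain ⟨h1, h2⟩ := (T.adj_ne_par_iff h0 (hD w)).1 ⟨hu, hne⟩
    have := ih u (by omega) (by omega)
    rwa [h2] at this

theorem eventually_stationary_down (n : ℕ) (w : V) (hn : h w = n + 1) :
    ∀ᶠ k in atTop, N.msg (k + 1) w (par w) = N.msg k w (par w) := by
  induction n generalizing w with
  | zero =>
    have h0 := T.level_par (w := w) (by omega) (hD w).le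
    refine eventually_stationary_of_forall (T.adj_par' (by omega) (hD w).le) fun u hu hne => ?_
    rcases T.of_adj _ u (hD _).le hu with h1 | h1
    · have h2 := ((T.adj_deeper_iff (hD _)).1 ⟨hu, h1⟩).2
      have := eventually_stationary_up T hD D u (by omega) (by omega)
      rwa [h2] at this
    · omega
  | succ n ih =>
    have h0 := T.level_par (w := w) (by omega) (hD w).le
    refine eventually_stationary_of_forall (T.adj_par' (by omega) (hD w).le) fun u hu hne => ?_
    rcases T.of_adj _ u (hD _).le hu with h1 | h1
    · have h2 := ((T.adj_deeper_iff (hD _)).1 ⟨hu, h1⟩).2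
      have := eventually_stationary_up T hD D u (by omega) (by omega)
      rwa [h2] at this
    · rw [h1.2]
      exact ih (par w) (by omega)

/-- On a tree the messages become stationary. -/
theorem exists_msg_stationary :
    ∃ K, ∀ k, K ≤ k → ∀ i j, N.graph.Adj i j → N.msg k i j = N.msg K i j := by
  have h1 : ∀ᶠ k in atTop, ∀ i j, N.graph.Adj i j → N.msg (k + 1) i j = N.msg k i j := by
    simp only [eventually_all]
    intro i j hij
    rcases T.of_adj i j (hD i).le hij with h1 | h1
    · have h2 := ((T.adj_deeper_iff (hD _)).1 ⟨hij, h1⟩).2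
      have := eventually_stationary_up T hD D j (by omega) (by omega)
      rwa [h2] at this
    · rw [h1.2]
      exact eventually_stationary_down T hD (h i - 1) i (by omega)
  obtain ⟨K, hK⟩ := eventually_atTop.1 h1
  refine ⟨K, fun k hk i j hij => ?_⟩
  induction k, hk using Nat.le_induction with
  | base => rfl
  | succ k hk ih => rw [hK k hk i j hij, ih]

end Stationary

section Limits

variable {K : ℕ} (hK : ∀ k, K ≤ k → ∀ i j, N.graph.Adj i j → N.msg k i j = N.msg K i j)

include hK

theorem varMsg_eq_of_stationary {i j : V} (hij : N.graph.Adj i j) {k : ℕ} (hk : K + 1 ≤ k) :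
    N.varMsg i j k = N.varUpdate (N.msg K) i j :=
  varUpdate_congr hij fun w hw _ => hK (k - 1) (by omega) i w hw

theorem covMsg_eq_of_stationary {i j : V} (hij : N.graph.Adj i j) {k : ℕ} (hk : K + 1 ≤ k) :
    N.covMsg i j k = N.covUpdate (N.msg K) i j := by
  have := varMsg_eq_of_stationary hK hij hk
  rw [varMsg] at this
  rw [covMsg, covUpdate, this, covUpdate]

theorem tendsto_varMsg {i j : V} (hij : N.graph.Adj i j) :
    Tendsto (N.varMsg i j) atTop (𝓝 (N.varUpdate (N.msg K) i j)) :=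
  tendsto_const_nhds.congr' (eventually_atTop.2
    ⟨K + 1, fun _ hk => (varMsg_eq_of_stationary hK hij hk).symm⟩)

theorem tendsto_covMsg {i j : V} (hij : N.graph.Adj i j) :
    Tendsto (N.covMsg i j) atTop (𝓝 (N.covUpdate (N.msg K) i j)) :=
  tendsto_const_nhds.congr' (eventually_atTop.2
    ⟨K + 1, fun _ hk => (covMsg_eq_of_stationary hK hij hk).symm⟩)

theorem varMsgLim_eq {i j : V} (hij : N.graph.Adj i j) :
    N.varMsgLim i j = N.varUpdate (N.msg K) i j :=
  (tendsto_varMsg hK hij).limUnder_eq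

theorem covMsgLim_eq {i j : V} (hij : N.graph.Adj i j) :
    N.covMsgLim i j = N.covUpdate (N.msg K) i j :=
  (tendsto_covMsg hK hij).limUnder_eq

theorem messagesConverge_of_stationary (hΩ : N.OmegaPos) : N.MessagesConverge := by
  intro i j hij
  rw [varMsgLim_eq hK hij, covMsgLim_eq hK hij]
  exact ⟨tendsto_varMsg hK hij, N.posDef_varUpdate_msg hΩ K hij, tendsto_covMsg hK hij⟩

theorem rho_lt_one (hΩ : N.OmegaPos) : N.rho < 1 := by
  have h1 : ∀ p : {p : V × V // N.graph.Adj p.1 p.2},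
      spectralNorm₂ (invSqrt (N.covMsgLim p.1.1 p.1.2) *
        (N.jointC s(p.1.1, p.1.2) p.1.1 * (N.varMsgLim p.1.1 p.1.2)⁻¹ *
          (N.jointC s(p.1.1, p.1.2) p.1.1)ᵀ) * invSqrt (N.covMsgLim p.1.1 p.1.2)) < 1 := by
    rintro ⟨⟨i, j⟩, hij⟩
    simp only
    rw [covMsgLim_eq hK hij, varMsgLim_eq hK hij]
    exact spectralNorm_schur_lt_one (N.jointR_posDef hij)
      (posSemidef_mul_mul_transpose (N.posDef_varUpdate_msg hΩ K hij).inv.posSemidef _)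
  rw [rho]
  rcases isEmpty_or_nonempty {p : V × V // N.graph.Adj p.1 p.2} with he | he
  · rw [Real.iSup_of_isEmpty]; exact one_pos
  · obtain ⟨p, hp⟩ := exists_eq_ciSup_of_finite (f := fun p : {p : V × V // N.graph.Adj p.1 p.2} =>
      spectralNorm₂ (invSqrt (N.covMsgLim p.1.1 p.1.2) *
        (N.jointC s(p.1.1, p.1.2) p.1.1 * (N.varMsgLim p.1.1 p.1.2)⁻¹ *
          (N.jointC s(p.1.1, p.1.2) p.1.1)ᵀ) * invSqrt (N.covMsgLim p.1.1 p.1.2)))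
    rw [← hp]
    exact h1 p

theorem rho_bound (hΩ : N.OmegaPos) {i j : V} (hij : N.graph.Adj i j)
    (u : Fin (N.l s(i, j)) → ℝ) :
    u ⬝ᵥ ((N.jointC s(i, j) i * (N.varUpdate (N.msg K) i j)⁻¹ * (N.jointC s(i, j) i)ᵀ) *ᵥ u) ≤
      N.rho * (u ⬝ᵥ (N.covUpdate (N.msg K) i j *ᵥ u)) := by
  refine form_le_of_spectralNorm_le
    (N.posDef_covUpdate hij (N.posDef_varUpdate_msg hΩ K hij)) ?_ u
  have := le_ciSup (f := fun p : {p : V × V // N.graph.Adj p.1 p.2} =>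
      spectralNorm₂ (invSqrt (N.covMsgLim p.1.1 p.1.2) *
        (N.jointC s(p.1.1, p.1.2) p.1.1 * (N.varMsgLim p.1.1 p.1.2)⁻¹ *
          (N.jointC s(p.1.1, p.1.2) p.1.1)ᵀ) * invSqrt (N.covMsgLim p.1.1 p.1.2)))
    (Set.finite_range _).bddAbove ⟨(i, j), hij⟩
  simp only at this
  rw [covMsgLim_eq hK hij, varMsgLim_eq hK hij] at this
  exact this

theorem alpha_bound (hΩ : N.OmegaPos) {i j : V} (hij : N.graph.Adj i j)
    (x : Fin (N.n i) → ℝ) :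
    x ⬝ᵥ (N.omega i j *ᵥ x) ≤ (1 + N.alpha) * (x ⬝ᵥ (N.varUpdate (N.msg K) i j *ᵥ x)) := by
  refine form_le_of_spectralNorm_sub_one_le (N.posDef_varUpdate_msg hΩ K hij) ?_ x
  have := le_ciSup (f := fun p : {p : V × V // N.graph.Adj p.1 p.2} =>
    spectralNorm₂ (invSqrt (N.varMsgLim p.1.1 p.1.2) * N.omega p.1.1 p.1.2 *
      invSqrt (N.varMsgLim p.1.1 p.1.2) - 1)) (Set.finite_range _).bddAbove ⟨(i, j), hij⟩
  simp only at this
  rw [varMsgLim_eq hK hij] at this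
  exact this

omit hK in
theorem alpha_nonneg : 0 ≤ N.alpha := Real.iSup_nonneg fun _ => norm_nonneg _

omit hK in
theorem rho_nonneg : 0 ≤ N.rho := Real.iSup_nonneg fun _ => norm_nonneg _

/-- One iteration improves the relative error of the messages by the factor `ρ`. -/
theorem msg_succ_form_le (hΩ : N.OmegaPos) {ε : ℝ} (hε : 0 ≤ ε) (k : ℕ) {i j : V}
    (hij : N.graph.Adj i j)
    (h : ∀ x, x ⬝ᵥ (N.varUpdate (N.msg k) j i *ᵥ x) ≤
      (1 + ε) * (x ⬝ᵥ (N.varUpdate (N.msg K) j i *ᵥ x))) (x : Fin (N.n i) → ℝ) :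
    x ⬝ᵥ (N.msg (k + 1) i j *ᵥ x) ≤ (1 + N.rho * ε) * (x ⬝ᵥ (N.msg K i j *ᵥ x)) := by
  rw [← hK (K + 1) (by omega) i j hij, msg, msg, dotProduct_conj_mulVec, dotProduct_conj_mulVec]
  exact form_schur_le_mul _ (N.jointR_posDef hij.symm) (N.posDef_varUpdate_msg hΩ K hij.symm)
    (N.posDef_varUpdate_msg hΩ k hij.symm) hε h (rho_bound hK hΩ hij.symm) _

theorem varUpdate_form_le (hΩ : N.OmegaPos) (k : ℕ) {i j : V} (hij : N.graph.Adj i j)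
    (x : Fin (N.n i) → ℝ) :
    x ⬝ᵥ (N.varUpdate (N.msg k) i j *ᵥ x) ≤
      (1 + N.alpha * N.rho ^ k) * (x ⬝ᵥ (N.varUpdate (N.msg K) i j *ᵥ x)) := by
  classical
  induction k generalizing i j with
  | zero =>
    rw [N.varUpdate_msg_zero hij, pow_zero, mul_one]
    exact alpha_bound hK hΩ hij x
  | succ k ih =>
    have hε : 0 ≤ N.alpha * N.rho ^ k := mul_nonneg alpha_nonneg (pow_nonneg rho_nonneg k)
    have hε' : 0 ≤ N.alpha * N.rho ^ (k + 1) :=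
      mul_nonneg alpha_nonneg (pow_nonneg rho_nonneg _)
    have h0 := mul_nonneg hε' (dotProduct_mulVec_nonneg (N.posSemidef_selfInfo i) x)
    rw [N.varUpdate_eq _ hij, N.varUpdate_eq _ hij, Matrix.add_mulVec, dotProduct_add,
      Matrix.add_mulVec, dotProduct_add, form_sum, form_sum, mul_add, Finset.mul_sum]
    refine add_le_add (by linarith) (Finset.sum_le_sum fun w hw => ?_)
    have hw' := (Finset.mem_filter.1 hw).2.1
    refine (msg_succ_form_le hK hΩ hε k hw' (fun y => ih hw'.symm y) x).trans_eq ?_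
    ring

/-- The information matrix after `k + 2` iterations is within the factor `1 + α ρ ^ (k + 1)` of its
limit. -/
theorem nodeUpdate_form_le (hΩ : N.OmegaPos) (k : ℕ) (i : V) (x : Fin (N.n i) → ℝ) :
    x ⬝ᵥ (N.nodeUpdate (N.msg (k + 1)) i *ᵥ x) ≤
      (1 + N.alpha * N.rho ^ (k + 1)) * (x ⬝ᵥ (N.nodeUpdate (N.msg K) i *ᵥ x)) := by
  classical
  have hε : 0 ≤ N.alpha * N.rho ^ k := mul_nonneg alpha_nonneg (pow_nonneg rho_nonneg k)
  have hε' : 0 ≤ N.alpha * N.rho ^ (k + 1) := mul_nonneg alpha_nonneg (pow_nonneg rho_nonneg _)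
  have h0 := mul_nonneg hε' (dotProduct_mulVec_nonneg (N.posSemidef_selfInfo i) x)
  rw [nodeUpdate, nodeUpdate, Matrix.add_mulVec, dotProduct_add,
    Matrix.add_mulVec, dotProduct_add, form_sum, form_sum, mul_add, Finset.mul_sum]
  refine add_le_add (by linarith) (Finset.sum_le_sum fun w hw => ?_)
  have hw' := (Finset.mem_filter.1 hw).2
  refine (msg_succ_form_le hK hΩ hε k hw' (fun y => varUpdate_form_le hK hΩ k hw'.symm y) x).trans_eq
    ?_
  ring

theorem nodeInfo_eq_of_stationary (i : V) {k : ℕ} (hk : K + 1 ≤ k) :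
    N.nodeInfo i k = N.nodeUpdate (N.msg K) i := by
  classical
  exact congrArg₂ _ rfl (Finset.sum_congr rfl fun w hw =>
    hK (k - 1) (by omega) i w (Finset.mem_filter.1 hw).2)

end Limits

end MeasurementSystem

/-! ### Gaussian integrals -/

section Gaussian

open ProbabilityTheory

variable {κ : Type*} [Fintype κ]

theorem withDensity_prod_gaussianPDFReal (β : κ → ℝ) :
    (volume : Measure (κ → ℝ)).withDensity
        (fun y => ENNReal.ofReal (∏ k, gaussianPDFReal (β k) 1 (y k))) =
      Measure.pi fun k => gaussianReal (β k) 1 := by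
  refine (Measure.pi_eq fun s hs => ?_).symm
  have hnn : ∀ y : κ → ℝ, 0 ≤ ∏ k, gaussianPDFReal (β k) 1 (y k) :=
    fun y => Finset.prod_nonneg fun k _ => gaussianPDFReal_nonneg _ _ _
  rw [withDensity_apply _ (MeasurableSet.univ_pi hs), volume_pi, Measure.restrict_pi_pi,
    ← ofReal_integral_eq_lintegral_ofReal
      (Integrable.fintype_prod fun k => (integrable_gaussianPDFReal (β k) 1).restrict)
      (ae_of_all _ hnn),
    integral_fintype_prod_eq_prod (fun k => gaussianPDFReal (β k) 1),
    ENNReal.ofReal_prod_of_nonneg fun k _ =>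
      integral_nonneg fun x => gaussianPDFReal_nonneg _ _ _]
  exact Finset.prod_congr rfl fun k _ => (gaussianReal_apply_eq_integral _ one_ne_zero _).symm

theorem prod_gaussianPDFReal_eq (β y : κ → ℝ) :
    ∏ k, gaussianPDFReal (β k) 1 (y k) =
      (Real.sqrt (2 * Real.pi))⁻¹ ^ Fintype.card κ * Real.exp (-(∑ k, (y k - β k) ^ 2) / 2) := by
  simp only [gaussianPDFReal, NNReal.coe_one, mul_one]
  rw [Finset.prod_mul_distrib, Finset.prod_const, ← Real.exp_sum, Finset.card_univ,
    ← Finset.sum_div, Finset.sum_neg_distrib]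

theorem covariance_pi_gaussianReal (β : κ → ℝ) (a b : κ → ℝ) :
    covariance (fun y => ∑ k, a k * y k) (fun y => ∑ k, b k * y k)
      (Measure.pi fun k => gaussianReal (β k) 1) = ∑ k, a k * b k := by
  classical
  have hL : ∀ k, MemLp (fun y : κ → ℝ => y k) 2 (Measure.pi fun k => gaussianReal (β k) 1) :=
    fun k => (memLp_id_gaussianReal 2).comp_measurePreserving (measurePreserving_eval _ k)
  have hind : iIndepFun (fun k (y : κ → ℝ) => y k) (Measure.pi fun k => gaussianReal (β k) 1) :=
    iIndepFun_pi (X := fun _ => id) fun _ => aemeasurable_id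
  rw [covariance_fun_sum_fun_sum (fun k => (hL k).const_mul _) (fun k => (hL k).const_mul _)]
  refine Finset.sum_congr rfl fun k _ => ?_
  rw [Finset.sum_eq_single k]
  · have hv : variance (fun y : κ → ℝ => y k) (Measure.pi fun k => gaussianReal (β k) 1) = 1 := by
      have h1 := variance_map (X := id) (Y := fun y : κ → ℝ => y k)
        (μ := Measure.pi fun k => gaussianReal (β k) 1) aemeasurable_id
        (measurable_pi_apply k).aemeasurable
      rw [(measurePreserving_eval (fun k => gaussianReal (β k) 1) k).map_eq,
        variance_id_gaussianReal] at h1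
      exact h1.symm
    rw [covariance_const_mul_left, covariance_const_mul_right,
      covariance_self (measurable_pi_apply k).aemeasurable, hv, mul_one]
  · intro l _ hl
    rw [covariance_const_mul_left, covariance_const_mul_right,
      (hind.indepFun hl.symm).covariance_eq_zero (hL k) (hL l), mul_zero, mul_zero]
  · simp

variable {E : Type*} [NormedAddCommGroup E] [NormedSpace ℝ E] [FiniteDimensional ℝ E]
  [MeasurableSpace E] [BorelSpace E] (μ : Measure E) [μ.IsAddHaarMeasure]

/-- A density that is Gaussian in suitable linear coordinates, normalized, is the law of independent
Gaussian coordinates. -/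
theorem normalized_withDensity_eq (f : E → ℝ) (L : (κ → ℝ) ≃L[ℝ] E) (β : κ → ℝ) {c : ℝ}
    (hc : 0 < c) (hf : Measurable f)
    (hfL : ∀ y, f (L y) = c * Real.exp (-(∑ k, (y k - β k) ^ 2) / 2)) :
    (μ.withDensity (fun x => ENNReal.ofReal (f x)) Set.univ)⁻¹ •
        μ.withDensity (fun x => ENNReal.ofReal (f x)) =
      (Measure.pi fun k => gaussianReal (β k) 1).map L := by
  set π : Measure (κ → ℝ) := Measure.pi fun k => gaussianReal (β k) 1 with hπ
  have hLm : Measurable L := L.continuous.measurable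
  have hfm : Measurable fun x => ENNReal.ofReal (f x) := hf.ennreal_ofReal
  set s : ℝ := (Real.sqrt (2 * Real.pi))⁻¹ ^ Fintype.card κ with hs
  have hs0 : 0 < s := by positivity
  have h1 : (fun y => ENNReal.ofReal (f (L y))) = ENNReal.ofReal (c / s) •
      fun y : κ → ℝ => ENNReal.ofReal (∏ k, gaussianPDFReal (β k) 1 (y k)) := by
    ext y
    rw [Pi.smul_apply, smul_eq_mul, ← ENNReal.ofReal_mul (by positivity),
      prod_gaussianPDFReal_eq, hfL, ← hs, ← mul_assoc, div_mul_cancel₀ _ hs0.ne']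
  set ν : Measure E := (volume : Measure (κ → ℝ)).map L with hν
  have hνH : ν.IsAddHaarMeasure := L.isAddHaarMeasure_map volume
  have h2 : ν.withDensity (fun x => ENNReal.ofReal (f x)) = ENNReal.ofReal (c / s) • π.map L := by
    have h3 : ν.withDensity (fun x => ENNReal.ofReal (f x)) =
        ((volume : Measure (κ → ℝ)).withDensity fun y => ENNReal.ofReal (f (L y))).map L := by
      ext t ht
      rw [withDensity_apply _ ht, hν, setLIntegral_map ht hfm hLm, Measure.map_apply hLm ht,
        withDensity_apply _ (hLm ht)]
    rw [h3, h1, withDensity_smul' _ _ ENNReal.ofReal_ne_top, withDensity_prod_gaussianPDFReal,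
      Measure.map_smul]
  have h4 : μ = (Measure.addHaarScalarFactor μ ν : ENNReal) • ν :=
    Measure.isAddLeftInvariant_eq_smul μ ν
  have h5 : μ.withDensity (fun x => ENNReal.ofReal (f x)) =
      ((Measure.addHaarScalarFactor μ ν : ENNReal) * ENNReal.ofReal (c / s)) • π.map L := by
    conv_lhs => rw [h4]
    rw [withDensity_smul_measure, h2, smul_smul]
  have hpm : IsProbabilityMeasure (π.map L) := Measure.isProbabilityMeasure_map hLm.aemeasurable
  have h6 : (Measure.addHaarScalarFactor μ ν : ENNReal) ≠ 0 := by
    exact_mod_cast (Measure.addHaarScalarFactor_pos_of_isAddHaarMeasure μ ν).ne'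
  rw [h5, Measure.smul_apply, measure_univ, smul_eq_mul, mul_one, smul_smul,
    ENNReal.inv_mul_cancel (mul_ne_zero h6 (by simp; positivity))
      (ENNReal.mul_ne_top ENNReal.coe_ne_top ENNReal.ofReal_ne_top), one_smul]

omit [FiniteDimensional ℝ E] in
include μ in
/-- A positive function with a period is not integrable, by Poincaré recurrence: the translation by
the period would preserve the finite measure with this density. -/
theorem not_integrable_of_periodic {f : E → ℝ} (hf : Measurable f) (hpos : ∀ x, 0 < f x) {w : E}
    (hw : ∀ x, f (x + w) = f x) (φ : E →L[ℝ] ℝ) (hφ : φ w ≠ 0) : ¬ Integrable f μ := by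
  intro hint
  set ν := μ.withDensity (fun x => ENNReal.ofReal (f x)) with hν
  have hfm : Measurable fun x => ENNReal.ofReal (f x) := hf.ennreal_ofReal
  have hfin : IsFiniteMeasure ν := isFiniteMeasure_withDensity_ofReal hint.2
  have hT : MeasurePreserving (fun x => x + w) ν ν := by
    refine ⟨measurable_add_const w, ?_⟩
    ext s hs
    have h1 := (measurePreserving_add_right μ w).setLIntegral_comp_preimage hs hfm
    simp only [hw] at h1
    rw [Measure.map_apply (measurable_add_const w) hs, withDensity_apply _ hs,
      withDensity_apply _ (measurable_add_const w hs), h1]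
  have hopen : IsOpen {x | |φ x| < |φ w| / 2} :=
    isOpen_lt (continuous_abs.comp φ.continuous) continuous_const
  have hs0 : ν {x | |φ x| < |φ w| / 2} ≠ 0 := by
    intro h0
    have h1 : μ ≪ ν := withDensity_absolutelyContinuous' hfm.aemeasurable
      (ae_of_all _ fun x => by simpa using hpos x)
    refine (hopen.measure_pos μ ⟨0, ?_⟩).ne' (h1 h0)
    simpa using hφ
  obtain ⟨x, hx, m, hm, hxm⟩ :=
    hT.exists_mem_iterate_mem hopen.measurableSet.nullMeasurableSet hs0
  have h2 : (fun x => x + w)^[m] x = x + (m : ℝ) • w := by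
    rw [add_right_iterate, Nat.cast_smul_eq_nsmul]
  rw [h2] at hxm
  have h3 : |φ x + m * φ w| < |φ w| / 2 := by simpa using hxm
  have h4 : |φ x| < |φ w| / 2 := hx
  have h5 : (1 : ℝ) ≤ m := by exact_mod_cast Nat.one_le_iff_ne_zero.2 hm
  have h6 : |(m : ℝ) * φ w| ≤ |φ x + m * φ w| + |φ x| := by
    have := abs_sub (φ x + m * φ w) (φ x)
    simpa using this
  rw [abs_mul, abs_of_nonneg (by positivity : (0 : ℝ) ≤ m)] at h6
  have h7 : |φ w| ≤ m * |φ w| := le_mul_of_one_le_left (abs_nonneg _) h5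
  linarith

end Gaussian

/-! ### Covariance matrices and constrained minima -/

section ConstrainedMin

variable {ι κ : Type*} [Fintype ι] [Fintype κ] {A : Matrix ι κ ℝ}

theorem posDef_mul_transpose_of_surjective (hA : Function.Surjective A.mulVec) :
    (A * Aᵀ).PosDef := by
  have hform : ∀ v, v ⬝ᵥ ((A * Aᵀ) *ᵥ v) = (Aᵀ *ᵥ v) ⬝ᵥ (Aᵀ *ᵥ v) := by
    intro v
    rw [← Matrix.mulVec_mulVec, dotProduct_mulVec_transpose]
  refine posDef_of_posSemidef_of_ker ?_ fun v hv => ?_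
  · have := Matrix.posSemidef_self_mul_conjTranspose A
    rwa [Matrix.conjTranspose_eq_transpose_of_trivial] at this
  · rw [hform, dotProduct_self_eq_zero] at hv
    obtain ⟨y, rfl⟩ := hA v
    rw [← dotProduct_self_eq_zero, dotProduct_mulVec_transpose, hv, dotProduct_zero]

theorem dotProduct_transpose_mulVec (y : κ → ℝ) (u : ι → ℝ) : y ⬝ᵥ (Aᵀ *ᵥ u) = (A *ᵥ y) ⬝ᵥ u := by
  rw [dotProduct_mulVec_transpose, Matrix.transpose_transpose, dotProduct_comm]

variable [DecidableEq ι]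

theorem mulVec_minNorm (hA : Function.Surjective A.mulVec) (v : ι → ℝ) :
    A *ᵥ (Aᵀ *ᵥ ((A * Aᵀ)⁻¹ *ᵥ v)) = v := by
  rw [Matrix.mulVec_mulVec, Matrix.mulVec_mulVec,
    posDef_mul_inv (posDef_mul_transpose_of_surjective hA), Matrix.one_mulVec]

/-- `vᵀ (A Aᵀ)⁻¹ v` is the minimum of `‖y‖²` subject to `A y = v`. -/
theorem form_inv_le (hA : Function.Surjective A.mulVec) (y : κ → ℝ) :
    (A *ᵥ y) ⬝ᵥ ((A * Aᵀ)⁻¹ *ᵥ (A *ᵥ y)) ≤ y ⬝ᵥ y := by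
  set u := (A * Aᵀ)⁻¹ *ᵥ (A *ᵥ y) with hu
  have h1 : 0 ≤ (y - Aᵀ *ᵥ u) ⬝ᵥ (y - Aᵀ *ᵥ u) := by
    simpa using dotProduct_star_self_nonneg (y - Aᵀ *ᵥ u)
  rw [sub_dotProduct, dotProduct_sub, dotProduct_sub, dotProduct_comm (Aᵀ *ᵥ u) y,
    dotProduct_transpose_mulVec y, dotProduct_transpose_mulVec _ u, hu, mulVec_minNorm hA, ← hu] at h1
  linarith

theorem exists_form_inv_eq (hA : Function.Surjective A.mulVec) (v : ι → ℝ) :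
    ∃ y, A *ᵥ y = v ∧ y ⬝ᵥ y = v ⬝ᵥ ((A * Aᵀ)⁻¹ *ᵥ v) := by
  refine ⟨Aᵀ *ᵥ ((A * Aᵀ)⁻¹ *ᵥ v), mulVec_minNorm hA v, ?_⟩
  rw [dotProduct_transpose_mulVec, mulVec_minNorm hA]

end ConstrainedMin

/-! ### Orthonormal coordinates of a positive definite form -/

theorem exists_orthonormal_coordinates {E : Type*} [AddCommGroup E] [Module ℝ E]
    [FiniteDimensional ℝ E] (B : LinearMap.BilinForm ℝ E) (hB : LinearMap.IsSymm B)
    (hpos : ∀ x, x ≠ 0 → 0 < B x x) :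
    ∃ L : (Fin (Module.finrank ℝ E) → ℝ) ≃ₗ[ℝ] E, ∀ y, B (L y) (L y) = y ⬝ᵥ y := by
  obtain ⟨v, hv⟩ := LinearMap.BilinForm.exists_orthogonal_basis (K := ℝ) (B := B) hB
  have h1 : ∀ k, 0 < B (v k) (v k) := fun k => hpos _ (v.ne_zero k)
  have h2 : ∀ k, IsUnit ((Real.sqrt (B (v k) (v k)))⁻¹) := fun k =>
    (inv_ne_zero (Real.sqrt_pos.2 (h1 k)).ne').isUnit
  set w := v.isUnitSMul h2 with hw
  have h3 : ∀ k l, B (w k) (w l) = if k = l then 1 else 0 := by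
    intro k l
    rw [hw, Module.Basis.isUnitSMul_apply, Module.Basis.isUnitSMul_apply]
    simp only [map_smul, LinearMap.smul_apply, smul_eq_mul]
    split_ifs with h
    · subst h
      have h4 := Real.mul_self_sqrt (h1 k).le
      have h5 := (Real.sqrt_pos.2 (h1 k)).ne'
      field_simp
      rw [sq, h4]
    · have h4 : B (v k) (v l) = 0 := hv h
      rw [h4]; ring
  refine ⟨w.equivFun.symm, fun y => ?_⟩
  rw [Module.Basis.equivFun_symm_apply]
  simp only [map_sum, map_smul, LinearMap.sum_apply, LinearMap.smul_apply, h3, smul_eq_mul,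
    mul_ite, mul_one, mul_zero, Finset.sum_ite_eq', Finset.mem_univ, if_true,
    dotProduct]

/-! ### The maximum likelihood information matrix -/

namespace MeasurementSystem

variable {V : Type*} [Fintype V] (N : MeasurementSystem V)

open Classical in
/-- The inner product on the space of all measured values that is given by the inverse noise
covariances. -/
noncomputable def dataForm : LinearMap.BilinForm ℝ
    (((i : V) → Fin (N.m i) → ℝ) × ((e : Sym2 V) → Fin (N.l e) → ℝ)) :=
  LinearMap.mk₂ ℝ (fun u v => ∑ i, u.1 i ⬝ᵥ ((N.selfR i)⁻¹ *ᵥ v.1 i) +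
      ∑ e with e ∈ N.graph.edgeSet, u.2 e ⬝ᵥ ((N.jointR e)⁻¹ *ᵥ v.2 e))
    (fun u u' v => by
      simp only [Prod.fst_add, Prod.snd_add, Pi.add_apply, add_dotProduct, Finset.sum_add_distrib]
      ring)
    (fun c u v => by
      simp only [Prod.smul_fst, Prod.smul_snd, Pi.smul_apply, smul_dotProduct, smul_eq_mul,
        mul_add, Finset.mul_sum])
    (fun u v v' => by
      simp only [Prod.fst_add, Prod.snd_add, Pi.add_apply, Matrix.mulVec_add, dotProduct_add,
        Finset.sum_add_distrib]
      ring)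
    (fun c u v => by
      simp only [Prod.smul_fst, Prod.smul_snd, Pi.smul_apply, Matrix.mulVec_smul, dotProduct_smul,
        smul_eq_mul, mul_add, Finset.mul_sum])

/-- The noiseless measured values of a configuration. -/
noncomputable def observe : ((i : V) → Fin (N.n i) → ℝ) →ₗ[ℝ]
    (((i : V) → Fin (N.m i) → ℝ) × ((e : Sym2 V) → Fin (N.l e) → ℝ)) where
  toFun X := (fun i => N.selfC i *ᵥ X i, fun e => N.edgeValue e X)
  map_add' X Y := by
    refine Prod.ext (funext fun i => Matrix.mulVec_add (N.selfC i) (X i) (Y i)) (funext fun e => ?_)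
    simp only [edgeValue, Pi.add_apply, Matrix.mulVec_add, Finset.sum_add_distrib, Prod.snd_add]
  map_smul' c X := by
    refine Prod.ext (funext fun i => Matrix.mulVec_smul (N.selfC i) c (X i)) (funext fun e => ?_)
    simp only [edgeValue, Pi.smul_apply, Matrix.mulVec_smul, Finset.smul_sum, Prod.smul_snd,
      RingHom.id_apply]

open Classical in
theorem dataForm_apply (u v : ((i : V) → Fin (N.m i) → ℝ) × ((e : Sym2 V) → Fin (N.l e) → ℝ)) :
    N.dataForm u v = ∑ i, u.1 i ⬝ᵥ ((N.selfR i)⁻¹ *ᵥ v.1 i) +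
      ∑ e with e ∈ N.graph.edgeSet, u.2 e ⬝ᵥ ((N.jointR e)⁻¹ *ᵥ v.2 e) := rfl

theorem dataForm_comm (u v : ((i : V) → Fin (N.m i) → ℝ) × ((e : Sym2 V) → Fin (N.l e) → ℝ)) :
    N.dataForm u v = N.dataForm v u := by
  classical
  rw [dataForm_apply, dataForm_apply]
  refine congrArg₂ _ (Finset.sum_congr rfl fun i _ => ?_) (Finset.sum_congr rfl fun e he => ?_)
  · rw [dotProduct_mulVec_transpose, transpose_eq_of_isHermitian (N.selfR_pos i).inv.1]
  · rw [dotProduct_mulVec_transpose,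
      transpose_eq_of_isHermitian (N.jointR_pos e (Finset.mem_filter.1 he).2).inv.1]

theorem energy_eq (X : (i : V) → Fin (N.n i) → ℝ) :
    N.energy X = N.dataForm (N.observe X) (N.observe X) := by
  classical
  rw [dataForm_apply, energy]
  refine congrArg₂ _ (Finset.sum_congr rfl fun i _ => ?_) rfl
  exact dotProduct_conj_mulVec _ _ _

/-- The normalization factor of the likelihood. -/
noncomputable def likelihoodConst : ℝ :=
  open Classical in
  (∏ i, (Real.sqrt ((2 * Real.pi) ^ N.m i * (N.selfR i).det))⁻¹) *
    ∏ e with e ∈ N.graph.edgeSet, (Real.sqrt ((2 * Real.pi) ^ N.l e * (N.jointR e).det))⁻¹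

theorem likelihoodConst_pos : 0 < N.likelihoodConst := by
  classical
  refine mul_pos (Finset.prod_pos fun i _ => ?_) (Finset.prod_pos fun e he => ?_)
  · have := (N.selfR_pos i).det_pos
    positivity
  · have := (N.jointR_pos e (Finset.mem_filter.1 he).2).det_pos
    positivity

theorem likelihood_eq (z : (i : V) → Fin (N.m i) → ℝ) (y : (e : Sym2 V) → Fin (N.l e) → ℝ)
    (X : (i : V) → Fin (N.n i) → ℝ) :
    N.likelihood z y X = N.likelihoodConst *
      Real.exp (-(N.dataForm ((z, y) - N.observe X) ((z, y) - N.observe X)) / 2) := by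
  classical
  rw [likelihood, likelihoodConst, dataForm_apply]
  simp only [gaussianDensity, Finset.prod_mul_distrib, ← Real.exp_sum]
  rw [mul_mul_mul_comm, ← Real.exp_add, ← Finset.sum_div, ← Finset.sum_div, ← add_div,
    Finset.sum_neg_distrib, Finset.sum_neg_distrib, ← neg_add]
  rfl

theorem measurable_likelihood (z : (i : V) → Fin (N.m i) → ℝ)
    (y : (e : Sym2 V) → Fin (N.l e) → ℝ) : Measurable (N.likelihood z y) := by
  classical
  have h0 : Continuous N.observe := LinearMap.continuous_of_finiteDimensional _
  have h1 : Continuous fun u => N.dataForm u u := by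
    simp only [dataForm_apply]
    fun_prop
  have h2 : N.likelihood z y = fun X => N.likelihoodConst *
      Real.exp (-(N.dataForm ((z, y) - N.observe X) ((z, y) - N.observe X)) / 2) :=
    funext (N.likelihood_eq z y)
  rw [h2]
  have h3 : Continuous fun X => N.dataForm ((z, y) - N.observe X) ((z, y) - N.observe X) :=
    h1.comp (continuous_const.sub h0)
  exact (continuous_const.mul (Real.continuous_exp.comp (h3.neg.div_const 2))).measurable

theorem energy_nonneg (X : (i : V) → Fin (N.n i) → ℝ) : 0 ≤ N.energy X := by
  classical
  exact add_nonneg (Finset.sum_nonneg fun i _ => N.selfEnergy_nonneg i _)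
    (Finset.sum_nonneg fun e he => N.edgeEnergy_nonneg (Finset.mem_filter.1 he).2 _)

theorem likelihood_add_of_energy_eq_zero (z : (i : V) → Fin (N.m i) → ℝ)
    (y : (e : Sym2 V) → Fin (N.l e) → ℝ) {W : (i : V) → Fin (N.n i) → ℝ} (hW : N.energy W = 0)
    (X : (i : V) → Fin (N.n i) → ℝ) : N.likelihood z y (X + W) = N.likelihood z y X := by
  classical
  have h1 : ∀ i ∈ Finset.univ, 0 ≤ N.selfEnergy i (W i) := fun i _ => N.selfEnergy_nonneg i _
  have h2 : ∀ e ∈ Finset.univ.filter (fun e => e ∈ N.graph.edgeSet), 0 ≤ N.edgeEnergy e W :=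
    fun e he => N.edgeEnergy_nonneg (Finset.mem_filter.1 he).2 _
  obtain ⟨h3, h4⟩ := (add_eq_zero_iff_of_nonneg (Finset.sum_nonneg h1) (Finset.sum_nonneg h2)).1 hW
  rw [Finset.sum_eq_zero_iff_of_nonneg h1] at h3
  rw [Finset.sum_eq_zero_iff_of_nonneg h2] at h4
  have h5 : ∀ i, N.selfC i *ᵥ W i = 0 := by
    intro i
    have := h3 i (Finset.mem_univ _)
    rw [selfEnergy, selfInfo, dotProduct_conj_mulVec] at this
    exact form_eq_zero_of_posDef (N.selfR_pos i).inv this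
  have h6 : ∀ e ∈ Finset.univ.filter (fun e => e ∈ N.graph.edgeSet), N.edgeValue e W = 0 :=
    fun e he =>
      form_eq_zero_of_posDef (N.jointR_pos e (Finset.mem_filter.1 he).2).inv (h4 e he)
  rw [likelihood, likelihood]
  refine congrArg₂ _ (Finset.prod_congr rfl fun i _ => ?_) (Finset.prod_congr rfl fun e he => ?_)
  · rw [Pi.add_apply, Matrix.mulVec_add, h5, add_zero]
  · have h7 := h6 e he
    rw [edgeValue] at h7
    simp only [Pi.add_apply, Matrix.mulVec_add, Finset.sum_add_distrib, h7, add_zero]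

variable {N}

/-- Integrability of the likelihood means that the joint information matrix is positive definite. -/
theorem energy_pos {z : (i : V) → Fin (N.m i) → ℝ} {y : (e : Sym2 V) → Fin (N.l e) → ℝ}
    (hf : Integrable (N.likelihood z y)) {W : (i : V) → Fin (N.n i) → ℝ} (hW : W ≠ 0) :
    0 < N.energy W := by
  refine lt_of_le_of_ne (N.energy_nonneg W) fun h0 => ?_
  obtain ⟨i, hi⟩ := Function.ne_iff.1 hW
  obtain ⟨a, ha⟩ := Function.ne_iff.1 hi
  refine not_integrable_of_periodic volume (N.measurable_likelihood z y) (fun X => ?_)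
    (N.likelihood_add_of_energy_eq_zero z y h0.symm)
    ((ContinuousLinearMap.proj (R := ℝ) (φ := fun _ : Fin (N.n i) => ℝ) a).comp
      (ContinuousLinearMap.proj (R := ℝ) (φ := fun i : V => Fin (N.n i) → ℝ) i)) ha hf
  rw [likelihood_eq]
  exact mul_pos N.likelihoodConst_pos (Real.exp_pos _)

/-- There are linear coordinates in which the energy is the square of the norm, and in terms of which
the maximum likelihood covariance of each node is a Gram matrix. -/
theorem exists_coordinates {z : (i : V) → Fin (N.m i) → ℝ} {y : (e : Sym2 V) → Fin (N.l e) → ℝ}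
    (hf : Integrable (N.likelihood z y)) :
    ∃ (k : ℕ) (L : (Fin k → ℝ) ≃ₗ[ℝ] ((i : V) → Fin (N.n i) → ℝ)),
      (∀ t, N.energy (L t) = t ⬝ᵥ t) ∧
      ∀ i, ∃ A : Matrix (Fin (N.n i)) (Fin k) ℝ, (∀ t, A *ᵥ t = L t i) ∧
        N.covML z y i = A * Aᵀ := by
  classical
  set B : LinearMap.BilinForm ℝ ((i : V) → Fin (N.n i) → ℝ) :=
    N.dataForm.compl₁₂ N.observe N.observe with hB
  have hBapp : ∀ X Y, B X Y = N.dataForm (N.observe X) (N.observe Y) := fun X Y => rfl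
  obtain ⟨L, hL⟩ := exists_orthonormal_coordinates B
    ⟨fun X Y => by rw [hBapp, hBapp, N.dataForm_comm]; rfl⟩
    (fun X hX => by rw [hBapp, ← energy_eq]; exact energy_pos hf hX)
  refine ⟨_, L, fun t => by rw [energy_eq, ← hBapp, hL], fun i => ?_⟩
  -- completing the square in the coordinates
  set b : (Fin (Module.finrank ℝ ((i : V) → Fin (N.n i) → ℝ)) → ℝ) →ₗ[ℝ] ℝ :=
    (N.dataForm (z, y)) ∘ₗ N.observe ∘ₗ L.toLinearMap with hb
  set β := fun k => b (Pi.single k 1) with hβ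
  have hbt : ∀ t, b t = ∑ k, t k * β k := by
    intro t
    conv_lhs => rw [pi_eq_sum_univ' t]
    simp only [map_sum, map_smul, smul_eq_mul, hβ]
  have hsq : ∀ t, N.dataForm ((z, y) - N.observe (L t)) ((z, y) - N.observe (L t)) =
      ∑ k, (t k - β k) ^ 2 + (N.dataForm (z, y) (z, y) - ∑ k, β k ^ 2) := by
    intro t
    have h1 : N.dataForm (z, y) (N.observe (L t)) = ∑ k, t k * β k := hbt t
    have h2 : N.dataForm (N.observe (L t)) (N.observe (L t)) = ∑ k, t k * t k := hL t
    have h3 : ∑ k, (t k - β k) ^ 2 = ∑ k, t k * t k - 2 * ∑ k, t k * β k + ∑ k, β k ^ 2 := by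
      rw [Finset.mul_sum, ← Finset.sum_sub_distrib, ← Finset.sum_add_distrib]
      exact Finset.sum_congr rfl fun k _ => by ring
    rw [LinearMap.map_sub₂, map_sub, map_sub, N.dataForm_comm (N.observe (L t)) (z, y), h1,
      h2, h3]
    ring
  have hlaw := normalized_withDensity_eq volume (N.likelihood z y) L.toContinuousLinearEquiv β
    (c := N.likelihoodConst * Real.exp (-(N.dataForm (z, y) (z, y) - ∑ k, β k ^ 2) / 2))
    (mul_pos N.likelihoodConst_pos (Real.exp_pos _)) (N.measurable_likelihood z y) (fun t => by
      rw [mul_assoc, ← Real.exp_add, N.likelihood_eq]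
      change _ * Real.exp
        (-(N.dataForm ((z, y) - N.observe (L t)) ((z, y) - N.observe (L t))) / 2) = _
      rw [hsq]
      ring_nf)
  have hmarg : N.marginalLaw z y i =
      (Measure.pi fun k => ProbabilityTheory.gaussianReal (β k) 1).map fun t => L t i := by
    rw [marginalLaw]
    rw [← Measure.map_smul, hlaw, Measure.map_map (measurable_pi_apply i)
      L.toContinuousLinearEquiv.continuous.measurable]
    rfl
  have hLm : Measurable fun t => L t i :=
    (measurable_pi_apply i).comp L.toContinuousLinearEquiv.continuous.measurable
  refine ⟨LinearMap.toMatrix' (LinearMap.proj i ∘ₗ L.toLinearMap), fun t => ?_, ?_⟩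
  · rw [LinearMap.toMatrix'_mulVec]; rfl
  · set A := LinearMap.toMatrix' ((LinearMap.proj i : ((i : V) → Fin (N.n i) → ℝ) →ₗ[ℝ] _) ∘ₗ
      L.toLinearMap) with hA
    have hAt : ∀ t a, L t i a = ∑ k, A a k * t k := by
      intro t a
      have : A *ᵥ t = L t i := by rw [hA, LinearMap.toMatrix'_mulVec]; rfl
      rw [← this]; rfl
    ext a b
    rw [covML, Matrix.of_apply, hmarg, ProbabilityTheory.covariance_map_fun
      (measurable_pi_apply a).aestronglyMeasurable (measurable_pi_apply b).aestronglyMeasurable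
      hLm.aemeasurable]
    simp only [hAt]
    rw [covariance_pi_gaussianReal]
    rfl

omit [Fintype V] in
theorem surjective_of_mulVec_eq {k : ℕ} {L : (Fin k → ℝ) ≃ₗ[ℝ] ((i : V) → Fin (N.n i) → ℝ)} {i : V}
    {A : Matrix (Fin (N.n i)) (Fin k) ℝ} (hA : ∀ t, A *ᵥ t = L t i) :
    Function.Surjective A.mulVec := by
  classical
  intro v
  refine ⟨L.symm (Function.update 0 i v), ?_⟩
  rw [hA, L.apply_symm_apply, Function.update_self]

/-- The maximum likelihood information matrix of a node is the minimal energy of a configuration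
with prescribed state of this node. -/
theorem infoML_form_le_energy {z : (i : V) → Fin (N.m i) → ℝ} {y : (e : Sym2 V) → Fin (N.l e) → ℝ}
    (hf : Integrable (N.likelihood z y)) (i : V) (X : (i : V) → Fin (N.n i) → ℝ) :
    X i ⬝ᵥ (N.infoML z y i *ᵥ X i) ≤ N.energy X := by
  obtain ⟨k, L, hL, h⟩ := exists_coordinates hf
  obtain ⟨A, hA, hcov⟩ := h i
  have := form_inv_le (surjective_of_mulVec_eq hA) (L.symm X)
  rwa [hA, L.apply_symm_apply, ← hL, L.apply_symm_apply, ← hcov] at this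

theorem exists_energy_eq_infoML_form {z : (i : V) → Fin (N.m i) → ℝ}
    {y : (e : Sym2 V) → Fin (N.l e) → ℝ} (hf : Integrable (N.likelihood z y)) (i : V)
    (v : Fin (N.n i) → ℝ) :
    ∃ X : (i : V) → Fin (N.n i) → ℝ, X i = v ∧ N.energy X = v ⬝ᵥ (N.infoML z y i *ᵥ v) := by
  obtain ⟨k, L, hL, h⟩ := exists_coordinates hf
  obtain ⟨A, hA, hcov⟩ := h i
  obtain ⟨t, ht, ht'⟩ := exists_form_inv_eq (surjective_of_mulVec_eq hA) v
  exact ⟨L t, by rw [← hA, ht], by rw [hL, ht', ← hcov]; rfl⟩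

theorem isHermitian_infoML {z : (i : V) → Fin (N.m i) → ℝ}
    {y : (e : Sym2 V) → Fin (N.l e) → ℝ} (hf : Integrable (N.likelihood z y)) (i : V) :
    (N.infoML z y i).IsHermitian := by
  obtain ⟨k, L, -, h⟩ := exists_coordinates hf
  obtain ⟨A, hA, hcov⟩ := h i
  rw [infoML, hcov]
  exact (posDef_mul_transpose_of_surjective (surjective_of_mulVec_eq hA)).inv.1

end MeasurementSystem

/-! ### Comparison of belief propagation with maximum likelihood -/

namespace MeasurementSystem

variable {V : Type*} [Fintype V] {N : MeasurementSystem V}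
  {z : (i : V) → Fin (N.m i) → ℝ} {y : (e : Sym2 V) → Fin (N.l e) → ℝ}

/-- Belief propagation never underestimates the information, since it computes the energy of a
configuration. -/
theorem posSemidef_nodeInfo_sub_infoML (hΩ : N.OmegaPos) (hf : Integrable (N.likelihood z y)) {i : V}
    {d : ℕ} (hd : 1 ≤ d) (hac : (N.graph.induce (hopBall N.graph i d)).IsAcyclic) :
    (N.nodeInfo i d - N.infoML z y i).PosSemidef := by
  obtain ⟨par, T⟩ := exists_isRootedUpTo hac
  refine posSemidef_of_form_nonneg
    ((N.posSemidef_nodeUpdate_msg hΩ (d - 1) i).1.sub (isHermitian_infoML hf i)) fun v => ?_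
  obtain ⟨X, rfl, hX⟩ := exists_energy_eq_nodeInfo_form T hΩ hd v
  rw [Matrix.sub_mulVec, dotProduct_sub, ← hX]
  exact sub_nonneg.2 (infoML_form_le_energy hf i X)

/-- Once the iterations have exhausted a tree, belief propagation is exact. -/
theorem nodeInfo_eq_infoML (hΩ : N.OmegaPos) (hf : Integrable (N.likelihood z y)) {i : V}
    {d : ℕ} (hd : 1 ≤ d) (hcard : Fintype.card V ≤ d)
    (hac : (N.graph.induce (hopBall N.graph i d)).IsAcyclic) :
    N.nodeInfo i d = N.infoML z y i := by
  refine eq_of_posSemidef_sub (posSemidef_nodeInfo_sub_infoML hΩ hf hd hac) ?_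
  obtain ⟨par, T⟩ := exists_isRootedUpTo hac
  refine posSemidef_of_form_nonneg
    ((isHermitian_infoML hf i).sub (N.posSemidef_nodeUpdate_msg hΩ (d - 1) i).1) fun v => ?_
  obtain ⟨X, rfl, hX⟩ := exists_energy_eq_infoML_form hf i v
  rw [Matrix.sub_mulVec, dotProduct_sub, ← hX]
  exact sub_nonneg.2 (nodeInfo_form_le_energy T hΩ hd (level_ne_of_card_lt hcard) X)

/-- The limit of belief propagation on the reduced graph bounds the maximum likelihood information
from below. -/
theorem reduced_form_le_infoML (hf : Integrable (N.likelihood z y)) {i : V} {d : ℕ}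
    (hΩ : (N.reduced i d).OmegaPos) {par : V → V}
    (T : IsRootedUpTo N.graph i d (level N.graph i d) par) {K : ℕ}
    (hK : ∀ k, K ≤ k → ∀ a b, (N.reduced i d).graph.Adj a b →
      (N.reduced i d).msg k a b = (N.reduced i d).msg K a b) (v : Fin (N.n i) → ℝ) :
    v ⬝ᵥ ((N.reduced i d).nodeUpdate ((N.reduced i d).msg K) (reducedRoot N.graph i d) *ᵥ v) ≤
      v ⬝ᵥ (N.infoML z y i *ᵥ v) := by
  obtain ⟨X, rfl, hX⟩ := exists_energy_eq_infoML_form hf i v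
  rw [← hX]
  refine le_trans ?_ (N.energy_reduced_le (i := i) (d := d) X)
  -- a depth beyond all levels at which the messages are stationary
  have h1 := nodeInfo_form_le_energy (d := K + d + 2)
    (isRootedUpTo_reducedGraph T (K + d + 2)) hΩ (by omega)
    (fun w => by have := reducedLevel_le w; omega) (fun a => X (reducedProj N.graph i d a))
  rw [nodeInfo_eq_of_stationary hK _ (by omega)] at h1
  exact h1

end MeasurementSystem

open MeasurementSystem in
theorem theorem4 {V : Type*} [Fintype V] (N : MeasurementSystem V) (hN : N.Dominance)
    (z : (i : V) → Fin (N.m i) → ℝ) (y : (e : Sym2 V) → Fin (N.l e) → ℝ)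
    (hf : Integrable (N.likelihood z y)) (i : V) :
    (∀ d : ℕ, cycleFreeDepth N.graph i = d → 1 ≤ d →
      (N.nodeInfo i d - N.infoML z y i).PosSemidef ∧
      (2 ≤ d → (N.reduced i d).OmegaPos →
        (N.reduced i d).MessagesConverge ∧ (N.reduced i d).rho < 1 ∧
        (((N.reduced i d).alpha * (N.reduced i d).rho ^ (d - 1)) • N.infoML z y i -
          (N.nodeInfo i d - N.infoML z y i)).PosSemidef)) ∧
    (cycleFreeDepth N.graph i = ⊤ →
      Tendsto (N.nodeInfo i) atTop (𝓝 (N.infoML z y i))) := by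
  have hΩ := hN.omegaPos
  refine ⟨fun d hcd hd => ?_, fun htop => ?_⟩
  · have hac := isAcyclic_ball_of_le_cycleFreeDepth hd hcd.ge
    refine ⟨posSemidef_nodeInfo_sub_infoML hΩ hf hd hac, fun hd2 hΩ' => ?_⟩
    obtain ⟨par, T⟩ := exists_isRootedUpTo hac
    obtain ⟨K, hK⟩ := exists_msg_stationary (N := N.reduced i d)
      (isRootedUpTo_reducedGraph T (d + 2)) fun w => by have := reducedLevel_le w; omega
    refine ⟨messagesConverge_of_stationary hK hΩ', rho_lt_one hK hΩ', ?_⟩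
    set c := (N.reduced i d).alpha * (N.reduced i d).rho ^ (d - 1) with hc
    have hc0 : 0 ≤ c := mul_nonneg alpha_nonneg (pow_nonneg rho_nonneg _)
    have hML := isHermitian_infoML hf i
    refine posSemidef_of_form_nonneg ((hML.smul (IsSelfAdjoint.all c)).sub
      ((N.posSemidef_nodeUpdate_msg hΩ (d - 1) i).1.sub hML)) fun v => ?_
    rw [Matrix.sub_mulVec, Matrix.sub_mulVec, dotProduct_sub, dotProduct_sub, form_smul]
    have h1 := reduced_form_le_infoML hf hΩ' T hK v
    have h2 := nodeUpdate_form_le hK hΩ' (d - 2) (reducedRoot N.graph i d) v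
    rw [show d - 2 + 1 = d - 1 by omega, ← hc] at h2
    have h3 : v ⬝ᵥ (N.nodeInfo i d *ᵥ v) ≤ _ :=
      (congrArg (fun A : Matrix (Fin (N.n i)) (Fin (N.n i)) ℝ => v ⬝ᵥ (A *ᵥ v))
        (N.nodeInfo_reduced hd)).symm.trans_le h2
    have h4 := h3.trans (mul_le_mul_of_nonneg_left h1 (by linarith))
    linarith
  · refine tendsto_const_nhds.congr' (eventually_atTop.2 ⟨Fintype.card V + 1, fun d hd => ?_⟩)
    exact (nodeInfo_eq_infoML hΩ hf (by omega) (by omega)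
      (isAcyclic_ball_of_le_cycleFreeDepth (by omega) (by rw [htop]; exact le_top))).symm
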